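/- **Setting.** Let $\mathcal M$ be a complete (finite-dimensional, smooth, without boundary) Riemannian manifold, complete meaning that every geodesic extends to all of $\mathbb R$, so that the exponential map $\mathrm{Exp}\colon \mathrm T\mathcal M\to\mathcal M$ is defined everywhere. Let $f\colon\mathcal M\to\mathbb R$ have Riemannian gradient $\mathrm{grad} f$ and Riemannian Hessian $\mathrm{Hess} f=\nabla\,\mathrm{grad} f$ (Levi-Civita connection). For $s\in \mathrm T_x\mathcal M$ let $P_s\colon \mathrm T_x\mathcal M\to \mathrm T_{\mathrm{Exp}_x(s)}\mathcal M$ be parallel transport along $t\mapsto \mathrm{Exp}_x(ts)$, $t\in[0,1]$. **Algorithm (Riemannian ARC with the exponential map).** Parameters: $\theta>0$, $\varsigma_{\min}>0$, $0<\eta_1\le\eta_2<1$, $0<\gamma_1<1<\gamma_2<\gamma_3$. Input: $x_0\in\mathcal M$, $\varsigma_0\ge\varsigma_{\min}$. For $k=0,1,2,\dots$: with the pullback $\hat f_k=f\circ\mathrm{Exp}_{x_k}$ and the model $$m_k(s)=\hat f_k(0)+\langle s,\nabla\hat f_k(0)\rangle+\tfrac12\langle s,\nabla^2\hat f_k(0)[s]\rangle+\tfrac{\varsigma_k}{3}\|s\|^3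 \quad\text{on } \mathrm T_{x_k}\mathcal M,$$ take any $s_k\in\mathrm T_{x_k}\mathcal M$ with $m_k(s_k)\le m_k(0)$ and $\|\nabla m_k(s_k)\|\le\theta\|s_k\|^2$. If $s_k=0$, terminate. Otherwise let $$\rho_k=\frac{f(x_k)-f(\mathrm{Exp}_{x_k}(s_k))}{m_k(0)-m_k(s_k)+\frac{\varsigma_k}{3}\|s_k\|^3}.$$ If $\rho_k\ge\eta_1$ (iteration $k$ is *successful*), set $x_{k+1}=\mathrm{Exp}_{x_k}(s_k)$; otherwise set $x_{k+1}=x_k$. Choose $\varsigma_{k+1}\in[\max(\varsigma_{\min},\gamma_1\varsigma_k),\varsigma_k]$ if $\rho_k\ge\eta_2$, $\varsigma_{k+1}\in[\varsigma_k,\gamma_2\varsigma_k]$ if $\rho_k\in[\eta_1,\eta_2)$, and $\varsigma_{k+1}\in[\gamma_2\varsigma_k,\gamma_3\varsigma_k]$ if $\rho_k<\eta_1$. **Assumptions**, for the (finite or infinite) run at hand and constants $f_{\mathrm{low}},L,L'\in\mathbb R$: * (A1) $f(x)\ge f_{\mathrm{low}}$ for all $x\in\mathcal M$. * (A2) $f$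 is twice continuously differentiable, and at each iteration $k$ (carried out with $s_k\neq 0$), $\hat f_k(s_k)-\big[\hat f_k(0)+\langle s_k,\nabla\hat f_k(0)\rangle+\frac12\langle s_k,\nabla^2\hat f_k(0)[s_k]\rangle\big]\le\frac L6\|s_k\|^3$. * (A3) At each successful iteration $k$, $\big\|P_{s_k}^{-1}\,\mathrm{grad} f(\mathrm{Exp}_{x_k}(s_k))-\mathrm{grad} f(x_k)-\mathrm{Hess} f(x_k)[s_k]\big\|\le\frac{L'}2\|s_k\|^2$. Let $\varsigma_{\max}=\max\!\big(\varsigma_0,\frac{L\gamma_3}{2(1-\eta_2)}\big)$ and $$K_1(\varepsilon)=\frac{3(f(x_0)-f_{\mathrm{low}})}{\eta_1\varsigma_{\min}}\Big(\frac{L'}2+\theta+\varsigma_{\max}\Big)^{1.5}\frac1{\varepsilon^{1.5}}.$$ (If the base $\frac{L'}2+\theta+\varsigma_{\max}$ is negative, which is possible only when there is no successful iteration, its power is read as $0$.) **Theorem.** Under these assumptions: 1. For every $\varepsilon>0$, the total number of successful iterations $k$ such that $\|\mathrm{grad} f(x_{k+1})\|>\varepsilon$ is finite and at most $K_1(\varepsilon)$.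 2. If the run is infinite, then $\lim_{k\to\infty}\|\mathrm{grad} f(x_k)\|=0$; if it terminates at iteration $n$, then $\mathrm{grad} f(x_n)=0$. 3. For every $\varepsilon>0$, the algorithm produces a point $x_k$ with $f(x_k)\le f(x_0)$ and $\|\mathrm{grad} f(x_k)\|\le\varepsilon$ in at most $$\Big(1+\frac{|\log\gamma_1|}{\log\gamma_2}\Big)K_1(\varepsilon)+\frac1{\log\gamma_2}\log\Big(\frac{\varsigma_{\max}}{\varsigma_0}\Big)+1$$ iterations, that is, for some $k$ not exceeding this number. -/

import Mathlib

open Set Filter Bundle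
open scoped Manifold ContDiff Bundle Topology

noncomputable section

namespace RiemannianARC

/-! ### Riemannian geometry

`M` is a smooth manifold without boundary modelled on the finite-dimensional space `E`; its
tangent spaces carry a Riemannian metric through `Bundle.RiemannianBundle`.  Coordinates around
`p₀ : M` are those of the preferred chart at `p₀`, and tangent vectors at nearby points are read in
these coordinates through the trivialization of the tangent bundle induced by the chart. -/

section Geometry

variable {E : Type*} [NormedAddCommGroup E] [NormedSpace ℝ E]
  {M : Type*} [TopologicalSpace M] [ChartedSpace E M] [IsManifold 𝓘(ℝ, E) ∞ M]

/-- The coordinates, in the chart at `p₀`, of a tangent vector at `p`. -/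
def toCoord (p₀ p : M) : TangentSpace 𝓘(ℝ, E) p →L[ℝ] E :=
  (trivializationAt E (TangentSpace 𝓘(ℝ, E) : M → Type _) p₀).continuousLinearMapAt ℝ p

/-- The tangent vector at `p` with given coordinates in the chart at `p₀`. -/
def ofCoord (p₀ p : M) : E →L[ℝ] TangentSpace 𝓘(ℝ, E) p :=
  (trivializationAt E (TangentSpace 𝓘(ℝ, E) : M → Type _) p₀).symmL ℝ p

/-- The velocity `γ'(t)` of a curve. -/
def velocity (γ : ℝ → M) (t : ℝ) : TangentSpace 𝓘(ℝ, E) (γ t) :=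
  mfderiv 𝓘(ℝ, ℝ) 𝓘(ℝ, E) γ t (1 : ℝ)

variable [RiemannianBundle (fun x : M ↦ TangentSpace 𝓘(ℝ, E) x)]

/-- The metric in the chart at `p₀`: `g_y(u, w)` for a coordinate point `y`. -/
def chartMetric (p₀ : M) (y u w : E) : ℝ :=
  inner ℝ (ofCoord p₀ ((extChartAt 𝓘(ℝ, E) p₀).symm y) u)
    (ofCoord p₀ ((extChartAt 𝓘(ℝ, E) p₀).symm y) w)

/-- The Christoffel symbols of the Riemannian (Levi-Civita) connection in the chart at `p₀`, as a
bilinear map: `Γ_y(u, v)` is the vector with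
`g_y(Γ_y(u, v), w) = (∂_u g(v, w) + ∂_v g(u, w) - ∂_w g(u, v)) / 2` for all `w`. -/
def christoffel (p₀ : M) (y u v : E) : E :=
  Classical.epsilon fun z : E ↦ ∀ w : E, chartMetric p₀ y z w =
    (fderiv ℝ (fun q ↦ chartMetric p₀ q v w) y u + fderiv ℝ (fun q ↦ chartMetric p₀ q u w) y v
      - fderiv ℝ (fun q ↦ chartMetric p₀ q u v) y w) / 2

/-- The covariant derivative `∇_s V` at `x` of a vector field `V` along `s`, computed in the chart
at `x`: `D V(x)[s] + Γ_x(s, V(x))` in coordinates. -/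
def covDeriv (V : ∀ p : M, TangentSpace 𝓘(ℝ, E) p) (x : M) (s : TangentSpace 𝓘(ℝ, E) x) :
    TangentSpace 𝓘(ℝ, E) x :=
  ofCoord x x
    (fderiv ℝ (fun y ↦ toCoord x ((extChartAt 𝓘(ℝ, E) x).symm y)
        (V ((extChartAt 𝓘(ℝ, E) x).symm y))) (extChartAt 𝓘(ℝ, E) x x) (toCoord x x s)
      + christoffel x (extChartAt 𝓘(ℝ, E) x x) (toCoord x x s) (toCoord x x (V x)))

/-- The vector field `Z` along the curve `γ` is parallel on the time set `J`: its covariant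
derivative along `γ` vanishes, that is, `ż + Γ(ċ, z) = 0` in every chart, where `c` and `z` are
the coordinates of `γ` and `Z`.  (Along a smooth curve such a `Z` is automatically smooth.) -/
def IsParallelOn (γ : ℝ → M) (Z : ∀ t, TangentSpace 𝓘(ℝ, E) (γ t)) (J : Set ℝ) : Prop :=
  ∀ p₀ : M, ∀ t ∈ J, γ t ∈ (chartAt E p₀).source →
    HasDerivWithinAt (fun τ ↦ toCoord p₀ (γ τ) (Z τ))
      (-christoffel p₀ (extChartAt 𝓘(ℝ, E) p₀ (γ t))
        (deriv (fun τ ↦ extChartAt 𝓘(ℝ, E) p₀ (γ τ)) t) (toCoord p₀ (γ t) (Z t))) J t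

/-- A geodesic defined for all times: a smooth curve whose velocity field is parallel (zero
intrinsic acceleration). -/
def IsGeodesic (γ : ℝ → M) : Prop :=
  ContMDiff 𝓘(ℝ, ℝ) 𝓘(ℝ, E) ∞ γ ∧ IsParallelOn (E := E) γ (velocity γ) univ

/-- The geodesic `γ` starts at `x` with velocity `v`. -/
def IsGeodesicFrom (x : M) (v : TangentSpace 𝓘(ℝ, E) x) (γ : ℝ → M) : Prop :=
  IsGeodesic (E := E) γ ∧ (⟨γ 0, velocity γ 0⟩ : TangentBundle 𝓘(ℝ, E) M) = ⟨x, v⟩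

variable (E M) in
/-- The Riemannian manifold is (geodesically) complete: every tangent vector is the initial
velocity of a geodesic defined on all of `ℝ`. -/
def IsGeodesicallyComplete : Prop :=
  ∀ (x : M) (v : TangentSpace 𝓘(ℝ, E) x), ∃ γ : ℝ → M, IsGeodesicFrom x v γ

open Classical in
/-- The exponential map `Exp_x(v) = γ_v(1)`, with `γ_v` the geodesic from `x` with velocity `v`
(and the value `x` if there is no geodesic defined for all times). -/
def Exp (x : M) (v : TangentSpace 𝓘(ℝ, E) x) : M :=
  if h : ∃ γ : ℝ → M, IsGeodesicFrom x v γ then h.choose 1 else x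

/-- The parallel transport along `γ` from time `0` to time `1` takes the tangent vector `p` at
`γ 0` to the tangent vector `q` at `γ 1`. -/
def IsParallelTransport (γ : ℝ → M) (p q : TangentBundle 𝓘(ℝ, E) M) : Prop :=
  ∃ Z : ∀ t, TangentSpace 𝓘(ℝ, E) (γ t), IsParallelOn γ Z (Icc 0 1) ∧
    (⟨γ 0, Z 0⟩ : TangentBundle 𝓘(ℝ, E) M) = p ∧ (⟨γ 1, Z 1⟩ : TangentBundle 𝓘(ℝ, E) M) = q

/-- `P_s⁻¹ w`, the vector `u` at `x` which parallel transport `P_s` along the geodesic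
`t ↦ Exp_x(t s)`, `0 ≤ t ≤ 1`, takes to the vector `w` at `Exp_x(s)`. -/
def transportInv (x : M) (s : TangentSpace 𝓘(ℝ, E) x) (w : TangentSpace 𝓘(ℝ, E) (Exp x s)) :
    TangentSpace 𝓘(ℝ, E) x :=
  Classical.epsilon fun u : TangentSpace 𝓘(ℝ, E) x ↦
    IsParallelTransport (fun t : ℝ ↦ Exp x (t • s)) ⟨x, u⟩ ⟨Exp x s, w⟩

variable [FiniteDimensional ℝ E]

instance tangentSpace_finiteDimensional (x : M) :
    FiniteDimensional ℝ (TangentSpace 𝓘(ℝ, E) x) :=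
  inferInstanceAs (FiniteDimensional ℝ E)

instance tangentSpace_completeSpace (x : M) : CompleteSpace (TangentSpace 𝓘(ℝ, E) x) :=
  FiniteDimensional.complete ℝ _

/-- The Riemannian gradient: `⟪grad f(x), s⟫ = D f(x)[s]`. -/
def grad (f : M → ℝ) (x : M) : TangentSpace 𝓘(ℝ, E) x :=
  (InnerProductSpace.toDual ℝ (TangentSpace 𝓘(ℝ, E) x)).symm (mvfderiv 𝓘(ℝ, E) f x)

/-- The Riemannian Hessian `Hess f(x)[s] = ∇_s grad f`. -/
def hess (f : M → ℝ) (x : M) (s : TangentSpace 𝓘(ℝ, E) x) : TangentSpace 𝓘(ℝ, E) x :=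
  covDeriv (grad f) x s

end Geometry

/-! ### The algorithm -/

/-- The second-order Taylor expansion at the origin
`h(0) + ⟪s, ∇h(0)⟫ + ⟪s, ∇²h(0)[s]⟫ / 2` of a function on a Euclidean space. -/
def taylor2 {V : Type*} [NormedAddCommGroup V] [InnerProductSpace ℝ V] [CompleteSpace V]
    (h : V → ℝ) (s : V) : ℝ :=
  h 0 + inner ℝ s (gradient h 0) + 1 / 2 * inner ℝ s (fderiv ℝ (gradient h) 0 s)

/-- The cubically regularized model of `h` with regularization parameter `ς`. -/
def cubicModel {V : Type*} [NormedAddCommGroup V] [InnerProductSpace ℝ V] [CompleteSpace V]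
    (h : V → ℝ) (ς : ℝ) (s : V) : ℝ :=
  taylor2 h s + ς / 3 * ‖s‖ ^ 3

/-- The parameters of the algorithm. -/
structure Params where
  θ : ℝ
  ςmin : ℝ
  η₁ : ℝ
  η₂ : ℝ
  γ₁ : ℝ
  γ₂ : ℝ
  γ₃ : ℝ
  θ_pos : 0 < θ
  ςmin_pos : 0 < ςmin
  η₁_pos : 0 < η₁
  η₁_le : η₁ ≤ η₂
  η₂_lt : η₂ < 1
  γ₁_pos : 0 < γ₁
  γ₁_lt : γ₁ < 1
  γ₂_gt : 1 < γ₂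
  γ₃_gt : γ₂ < γ₃

section Algorithm

variable {E : Type*} [NormedAddCommGroup E] [NormedSpace ℝ E] [FiniteDimensional ℝ E]
  {M : Type*} [TopologicalSpace M] [ChartedSpace E M] [IsManifold 𝓘(ℝ, E) ∞ M]
  [RiemannianBundle (fun x : M ↦ TangentSpace 𝓘(ℝ, E) x)]

/-- The model on `T_x M` of the pullback `f ∘ R_x`. -/
def model (f : M → ℝ) (R : ∀ x : M, TangentSpace 𝓘(ℝ, E) x → M) (x : M) (ς : ℝ)
    (s : TangentSpace 𝓘(ℝ, E) x) : ℝ :=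
  cubicModel (fun v ↦ f (R x v)) ς s

/-- The regularized ratio `ρ` of actual to model improvement. -/
def ratio (f : M → ℝ) (R : ∀ x : M, TangentSpace 𝓘(ℝ, E) x → M) (x : M) (ς : ℝ)
    (s : TangentSpace 𝓘(ℝ, E) x) : ℝ :=
  (f x - f (R x s)) / (model f R x ς 0 - model f R x ς s + ς / 3 * ‖s‖ ^ 3)

open Classical in
/-- `(x k, s k, ς k)` are the iterates, trial steps and regularization parameters of a run of the
adaptive cubic regularization algorithm on `f` with retraction `R`.  The run terminates at
iteration `N`, where the solver returns the step `0`, or is infinite if `N = ⊤`; the iterations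
`k < N` are carried out in full, and the values of the sequences after iteration `N` are
irrelevant. -/
structure IsRun (P : Params) (f : M → ℝ) (R : ∀ x : M, TangentSpace 𝓘(ℝ, E) x → M) (N : ℕ∞)
    (x : ℕ → M) (s : ∀ k, TangentSpace 𝓘(ℝ, E) (x k)) (ς : ℕ → ℝ) : Prop where
  init : P.ςmin ≤ ς 0
  decrease : ∀ k : ℕ, (k : ℕ∞) ≤ N → model f R (x k) (ς k) (s k) ≤ model f R (x k) (ς k) 0
  progress : ∀ k : ℕ, (k : ℕ∞) ≤ N →
    ‖gradient (model f R (x k) (ς k)) (s k)‖ ≤ P.θ * ‖s k‖ ^ 2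
  terminate_iff : ∀ k : ℕ, (k : ℕ∞) ≤ N → (s k = 0 ↔ (k : ℕ∞) = N)
  step : ∀ k : ℕ, (k : ℕ∞) < N →
    x (k + 1) = if P.η₁ ≤ ratio f R (x k) (ς k) (s k) then R (x k) (s k) else x k
  very_successful : ∀ k : ℕ, (k : ℕ∞) < N → P.η₂ ≤ ratio f R (x k) (ς k) (s k) →
    ς (k + 1) ∈ Icc (max P.ςmin (P.γ₁ * ς k)) (ς k)
  successful : ∀ k : ℕ, (k : ℕ∞) < N → P.η₁ ≤ ratio f R (x k) (ς k) (s k) →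
    ratio f R (x k) (ς k) (s k) < P.η₂ → ς (k + 1) ∈ Icc (ς k) (P.γ₂ * ς k)
  unsuccessful : ∀ k : ℕ, (k : ℕ∞) < N → ratio f R (x k) (ς k) (s k) < P.η₁ →
    ς (k + 1) ∈ Icc (P.γ₂ * ς k) (P.γ₃ * ς k)

end Algorithm

/-- The bound `ς_max` on the regularization parameters. -/
def ςmax (P : Params) (L ς₀ : ℝ) : ℝ :=
  max ς₀ (L * P.γ₃ / (2 * (1 - P.η₂)))

/-- The bound `K₁(ε)` on the number of successful iterations leading to a large gradient, in terms
of the initial cost gap `Δ = f(x₀) - f_low`. -/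
def K₁ (P : Params) (L L' ς₀ Δ ε : ℝ) : ℝ :=
  3 * Δ / (P.η₁ * P.ςmin) * (L' / 2 + P.θ + ςmax P L ς₀) ^ (3 / 2 : ℝ) * (1 / ε ^ (3 / 2 : ℝ))

end RiemannianARC

end

/-!
Two estimates carry the theorem.  A successful iteration decreases `f` by at least
`η₁ ς_min ‖s‖³ / 3`, by definition of the ratio; and the gradient at its end is at most
`(L' / 2 + θ + ς_max) ‖s‖²` (`norm_grad_Exp_le`), so that a large gradient forces a long step.  The
number of successful iterations leading to a gradient larger than `ε` is therefore bounded by the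
total decrease `f(x₀) - f_low` divided by the least decrease of such an iteration
(`RunEstimates.card_le`).  The regularization parameter stays below `ς_max`
(`IsRun.le_ςmax`) and is multiplied by at least `γ₂` at each unsuccessful iteration, so unsuccessful
iterations are controlled by successful ones (`RunEstimates.log_reg_ge`).

The second estimate is where the geometry enters.  The assumption on `P_s⁻¹ grad f(Exp_x(s))` bounds
`grad f(Exp_x(s))` itself because parallel transport exists and is isometric (`norm_transportInv`),
and the condition `‖∇m(s)‖ ≤ θ ‖s‖²` on the model is usable because the gradient and the Hessian of
the pullback `f ∘ Exp_x` at the origin are `grad f(x)` and `Hess f(x)` (`gradient_pullback`,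
`hessian_pullback`).  The latter requires the following facts about geodesics.

* `Exp_x` is `C²` near the origin (`exists_local_exp`, `exists_coord_Exp`).  Smooth dependence of
  geodesics on the initial velocity is obtained from the inverse function theorem in a space of
  continuous curves, where superposition operators are smooth (`contDiff_superposition`).
* Geodesics are unique (`IsGeodesic.eqOn`), hence `Exp_x(t v)` is the geodesic `γ_v(t)` (`Exp_smul`).
  The second derivative of the pullback along a ray is thus the second derivative of `f` along a
  geodesic, which is `Hess f(v, v)` by the geodesic equation; polarization gives the whole Hessian.
* Geodesics satisfy the geodesic equation in every chart, which yields the transformation rule of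
  the Christoffel symbols (`christoffelCLM_chart_change`).  With it, solutions of the parallel
  transport equation in one chart are solutions in all charts, and can be glued along `[0, 1]`.
-/

noncomputable section

namespace RiemannianARC

set_option maxSynthPendingDepth 3
set_option linter.unusedSectionVars false

/-! ### Metrics on a vector space and their Christoffel symbols -/

section MetricCalculus

variable {E : Type*} [NormedAddCommGroup E] [NormedSpace ℝ E]

/-- The trilinear form `(u, v, w) ↦ (D(u, v, w) + D(v, u, w) - D(w, u, v)) / 2`.  With `D` the
derivative of the metric it is the right-hand side of the Koszul formula. -/
def koszul (D : E →L[ℝ] E →L[ℝ] E →L[ℝ] ℝ) : E →L[ℝ] E →L[ℝ] E →L[ℝ] ℝ :=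
  (1 / 2 : ℝ) • (D + D.flip - ((ContinuousLinearMap.flipₗᵢ ℝ E E ℝ).toContinuousLinearEquiv :
        (E →L[ℝ] E →L[ℝ] ℝ) →L[ℝ] (E →L[ℝ] E →L[ℝ] ℝ)) ∘L D.flip)

lemma koszul_apply (D : E →L[ℝ] E →L[ℝ] E →L[ℝ] ℝ) (u v w : E) :
    koszul D u v w = (D u v w + D v u w - D w u v) / 2 := by
  simp [koszul]
  ring

lemma contDiff_koszul {n : WithTop ℕ∞} :
    ContDiff ℝ n (koszul : (E →L[ℝ] E →L[ℝ] E →L[ℝ] ℝ) → _) := by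
  have hflip : ContDiff ℝ n (fun D : E →L[ℝ] E →L[ℝ] E →L[ℝ] ℝ ↦ D.flip) :=
    (ContinuousLinearMap.flipₗᵢ ℝ E E (E →L[ℝ] ℝ)).contDiff
  unfold koszul
  exact ((contDiff_id.add hflip).sub (contDiff_const.clm_comp hflip)).const_smul (1 / 2 : ℝ)

/-- The Christoffel symbols of a metric `g`, given on an open set of a vector space, as a
continuous bilinear map. -/
def christoffelOf (g : E → E →L[ℝ] E →L[ℝ] ℝ) (y : E) : E →L[ℝ] E →L[ℝ] E :=
  (ContinuousLinearMap.compL ℝ E (E →L[ℝ] ℝ) E (g y).inverse) ∘L koszul (fderiv ℝ g y)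

lemma fderiv_apply_apply {g : E → E →L[ℝ] E →L[ℝ] ℝ} {y : E} (hg : DifferentiableAt ℝ g y)
    (u v w : E) : fderiv ℝ (fun q ↦ g q v w) y u = fderiv ℝ g y u v w := by
  have h2 := (hg.hasFDerivAt.clm_apply (hasFDerivAt_const v y)).clm_apply (hasFDerivAt_const w y)
  rw [h2.fderiv]
  simp

variable [FiniteDimensional ℝ E]

lemma exists_equiv_of_injective {b : E →L[ℝ] E →L[ℝ] ℝ} (hb : Function.Injective b) :
    ∃ e : E ≃L[ℝ] (E →L[ℝ] ℝ), (e : E →L[ℝ] E →L[ℝ] ℝ) = b := by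
  have hd : Module.finrank ℝ E = Module.finrank ℝ (E →L[ℝ] ℝ) := by
    rw [← (LinearMap.toContinuousLinearMap (𝕜 := ℝ) (E := E) (F' := ℝ)).finrank_eq]
    exact (Subspace.dual_finrank_eq).symm
  let e := LinearEquiv.ofInjectiveOfFinrankEq b.toLinearMap hb hd
  exact ⟨e.toContinuousLinearEquiv, by ext u w; rfl⟩

lemma apply_inverse_of_injective {b : E →L[ℝ] E →L[ℝ] ℝ} (hb : Function.Injective b)
    (l : E →L[ℝ] ℝ) : b (b.inverse l) = l := by
  obtain ⟨e, rfl⟩ := exists_equiv_of_injective hb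
  rw [ContinuousLinearMap.inverse_equiv]
  simp

lemma contDiffAt_inverse_of_injective {n : WithTop ℕ∞} {g : E → E →L[ℝ] E →L[ℝ] ℝ} {y : E}
    (hb : Function.Injective (g y)) (hg : ContDiffAt ℝ n g y) :
    ContDiffAt ℝ n (fun y ↦ (g y).inverse) y := by
  obtain ⟨e, he⟩ := exists_equiv_of_injective hb
  have := contDiffAt_map_inverse (n := n) e
  rw [he] at this
  exact this.comp y hg

lemma apply_christoffelOf {g : E → E →L[ℝ] E →L[ℝ] ℝ} {y : E} (hb : Function.Injective (g y))
    (u v w : E) :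
    g y (christoffelOf g y u v) w
      = (fderiv ℝ g y u v w + fderiv ℝ g y v u w - fderiv ℝ g y w u v) / 2 := by
  rw [← koszul_apply]
  change g y ((g y).inverse (koszul (fderiv ℝ g y) u v)) w = _
  rw [apply_inverse_of_injective hb]

lemma contDiffAt_christoffelOf {g : E → E →L[ℝ] E →L[ℝ] ℝ} {y : E}
    (hb : Function.Injective (g y)) (hg : ContDiffAt ℝ ∞ g y) :
    ContDiffAt ℝ ∞ (christoffelOf g) y := by
  have hD : ContDiffAt ℝ ∞ (fderiv ℝ g) y := hg.fderiv_right (by simp)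
  exact ((ContinuousLinearMap.compL ℝ E (E →L[ℝ] ℝ) E).contDiff.contDiffAt.comp y
    (contDiffAt_inverse_of_injective hb hg)).clm_comp (contDiff_koszul.contDiffAt.comp y hD)

end MetricCalculus

/-! ### Coordinates of points and tangent vectors -/

section Charts

variable {E : Type*} [NormedAddCommGroup E] [NormedSpace ℝ E]
  {M : Type*} [TopologicalSpace M] [ChartedSpace E M] [IsManifold 𝓘(ℝ, E) ∞ M]

lemma toCoord_ofCoord {p₀ p : M} (h : p ∈ (chartAt E p₀).source) (v : E) :
    toCoord p₀ p (ofCoord p₀ p v) = v :=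
  Trivialization.continuousLinearMapAt_symmL (R := ℝ)
    (trivializationAt E (TangentSpace 𝓘(ℝ, E) : M → Type _) p₀) h v

lemma ofCoord_toCoord {p₀ p : M} (h : p ∈ (chartAt E p₀).source) (v : TangentSpace 𝓘(ℝ, E) p) :
    ofCoord p₀ p (toCoord p₀ p v) = v :=
  Trivialization.symmL_continuousLinearMapAt (R := ℝ)
    (trivializationAt E (TangentSpace 𝓘(ℝ, E) : M → Type _) p₀) h v

lemma chart_symm_mem {p₀ : M} {y : E} (hy : y ∈ (extChartAt 𝓘(ℝ, E) p₀).target) :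
    (extChartAt 𝓘(ℝ, E) p₀).symm y ∈ (chartAt E p₀).source := by
  simpa using (extChartAt 𝓘(ℝ, E) p₀).map_target hy

lemma chart_mem {p₀ p : M} (h : p ∈ (chartAt E p₀).source) :
    extChartAt 𝓘(ℝ, E) p₀ p ∈ (extChartAt 𝓘(ℝ, E) p₀).target :=
  (extChartAt 𝓘(ℝ, E) p₀).map_source (by simpa using h)

lemma chart_left_inv {p₀ p : M} (h : p ∈ (chartAt E p₀).source) :
    (extChartAt 𝓘(ℝ, E) p₀).symm (extChartAt 𝓘(ℝ, E) p₀ p) = p :=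
  (extChartAt 𝓘(ℝ, E) p₀).left_inv (by simpa using h)

lemma chart_mdifferentiableAt {p₀ p : M} (h : p ∈ (chartAt E p₀).source) :
    MDifferentiableAt 𝓘(ℝ, E) 𝓘(ℝ, E) (extChartAt 𝓘(ℝ, E) p₀) p :=
  mdifferentiableAt_extChartAt h

lemma chart_symm_contMDiffAt {p₀ : M} {y : E} (hy : y ∈ (extChartAt 𝓘(ℝ, E) p₀).target) :
    ContMDiffAt 𝓘(ℝ, E) 𝓘(ℝ, E) ∞ (extChartAt 𝓘(ℝ, E) p₀).symm y :=
  (contMDiffOn_extChartAt_symm p₀).contMDiffAt ((isOpen_extChartAt_target p₀).mem_nhds hy)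

lemma toCoord_eq_mfderiv {p₀ p : M} (h : p ∈ (chartAt E p₀).source) :
    toCoord p₀ p = mfderiv 𝓘(ℝ, E) 𝓘(ℝ, E) (extChartAt 𝓘(ℝ, E) p₀) p :=
  TangentBundle.continuousLinearMapAt_trivializationAt h

lemma ofCoord_eq_mfderiv {p₀ p : M} (h : p ∈ (chartAt E p₀).source) (v : E) :
    (ofCoord p₀ p v : E) = (mfderiv 𝓘(ℝ, E) 𝓘(ℝ, E) (extChartAt 𝓘(ℝ, E) p₀).symm
      (extChartAt 𝓘(ℝ, E) p₀ p) v : E) := by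
  have := TangentBundle.symmL_trivializationAt (I := 𝓘(ℝ, E)) h
  rw [show range 𝓘(ℝ, E) = univ by simp, mfderivWithin_univ] at this
  exact congrArg (fun l : E →L[ℝ] E ↦ l v) this

/-- The derivative of a change of charts, in terms of the coordinates of tangent vectors. -/
lemma fderiv_chart_change {p₀ q z : M} (h : z ∈ (chartAt E p₀).source)
    (hq : z ∈ (chartAt E q).source) (v : E) :
    fderiv ℝ (extChartAt 𝓘(ℝ, E) p₀ ∘ (extChartAt 𝓘(ℝ, E) q).symm) (extChartAt 𝓘(ℝ, E) q z) v
      = toCoord p₀ z (ofCoord q z v) := by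
  have h1 := (chart_symm_contMDiffAt (chart_mem hq)).mdifferentiableAt (by simp)
  have h2 : MDifferentiableAt 𝓘(ℝ, E) 𝓘(ℝ, E) (extChartAt 𝓘(ℝ, E) p₀)
      ((extChartAt 𝓘(ℝ, E) q).symm (extChartAt 𝓘(ℝ, E) q z)) := by
    rw [chart_left_inv hq]; exact chart_mdifferentiableAt h
  rw [← mfderiv_eq_fderiv, mfderiv_comp _ h2 h1, toCoord_eq_mfderiv h]
  have h3 := congrArg₂ (fun (l : E →L[ℝ] E) (u : E) ↦ l u)
    (congrArg (fun p : M ↦ (mfderiv 𝓘(ℝ, E) 𝓘(ℝ, E) (extChartAt 𝓘(ℝ, E) p₀) p : E →L[ℝ] E))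
      (chart_left_inv hq)) (ofCoord_eq_mfderiv hq v).symm
  exact h3

lemma chart_change_contDiffAt {p₀ q z : M} (h : z ∈ (chartAt E p₀).source)
    (hq : z ∈ (chartAt E q).source) :
    ContDiffAt ℝ ∞ (extChartAt 𝓘(ℝ, E) p₀ ∘ (extChartAt 𝓘(ℝ, E) q).symm)
      (extChartAt 𝓘(ℝ, E) q z) := by
  rw [← contMDiffAt_iff_contDiffAt]
  refine ContMDiffAt.comp _ ?_ (chart_symm_contMDiffAt (chart_mem hq))
  rw [chart_left_inv hq]
  exact contMDiffAt_extChartAt' h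

/-- The coordinates of the velocity of a curve are the derivative of its coordinates. -/
lemma toCoord_velocity {γ : ℝ → M} {t : ℝ} {p₀ : M} (h : γ t ∈ (chartAt E p₀).source)
    (hγ : MDifferentiableAt 𝓘(ℝ, ℝ) 𝓘(ℝ, E) γ t) :
    toCoord p₀ (γ t) (velocity γ t) = deriv (fun τ ↦ extChartAt 𝓘(ℝ, E) p₀ (γ τ)) t := by
  rw [← fderiv_apply_one_eq_deriv, ← mfderiv_eq_fderiv]
  have := mfderiv_comp t (chart_mdifferentiableAt (E := E) h) hγ
  change _ = mfderiv 𝓘(ℝ, ℝ) 𝓘(ℝ, E) ((extChartAt 𝓘(ℝ, E) p₀) ∘ γ) t (1 : ℝ)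
  rw [this, toCoord_eq_mfderiv h]
  rfl

/-- A real function read in a chart has derivative `mfderiv f` composed with `ofCoord`. -/
lemma fderiv_comp_chart_symm {f : M → ℝ} {q z : M} (hq : z ∈ (chartAt E q).source)
    (hf : MDifferentiableAt 𝓘(ℝ, E) 𝓘(ℝ, ℝ) f z) (v : E) :
    fderiv ℝ (f ∘ (extChartAt 𝓘(ℝ, E) q).symm) (extChartAt 𝓘(ℝ, E) q z) v
      = mvfderiv 𝓘(ℝ, E) f z (ofCoord q z v) := by
  have h1 := (chart_symm_contMDiffAt (chart_mem hq)).mdifferentiableAt (by simp)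
  have h2 : MDifferentiableAt 𝓘(ℝ, E) 𝓘(ℝ, ℝ) f
      ((extChartAt 𝓘(ℝ, E) q).symm (extChartAt 𝓘(ℝ, E) q z)) := by
    rwa [chart_left_inv hq]
  rw [← mfderiv_eq_fderiv, mfderiv_comp _ h2 h1]
  have h3 := congrArg₂ (fun (l : E →L[ℝ] ℝ) (u : E) ↦ l u)
    (congrArg (fun p : M ↦ (mfderiv 𝓘(ℝ, E) 𝓘(ℝ, ℝ) f p : E →L[ℝ] ℝ))
      (chart_left_inv hq)) (ofCoord_eq_mfderiv hq v).symm
  exact h3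

lemma comp_chart_symm_contDiffAt {f : M → ℝ} {n : ℕ∞} (hf : ContMDiff 𝓘(ℝ, E) 𝓘(ℝ, ℝ) n f)
    {q : M} {y : E} (hy : y ∈ (extChartAt 𝓘(ℝ, E) q).target) :
    ContDiffAt ℝ n (f ∘ (extChartAt 𝓘(ℝ, E) q).symm) y := by
  rw [← contMDiffAt_iff_contDiffAt]
  exact hf.contMDiffAt.comp _ ((chart_symm_contMDiffAt hy).of_le (by exact_mod_cast le_top))

end Charts

/-! ### The metric and the Christoffel symbols in a chart -/

section Metric

variable {E : Type*} [NormedAddCommGroup E] [NormedSpace ℝ E]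
  {M : Type*} [TopologicalSpace M] [ChartedSpace E M] [IsManifold 𝓘(ℝ, E) ∞ M]
  [RiemannianBundle (fun x : M ↦ TangentSpace 𝓘(ℝ, E) x)]

/-- The metric in the chart at `p₀`, as a bilinear form depending on the coordinate point. -/
def metricCLM (p₀ : M) (y : E) : E →L[ℝ] E →L[ℝ] ℝ :=
  (innerSL ℝ (E := TangentSpace 𝓘(ℝ, E) ((extChartAt 𝓘(ℝ, E) p₀).symm y))).bilinearComp
    (ofCoord p₀ ((extChartAt 𝓘(ℝ, E) p₀).symm y)) (ofCoord p₀ ((extChartAt 𝓘(ℝ, E) p₀).symm y))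

lemma metricCLM_apply (p₀ : M) (y u w : E) : metricCLM p₀ y u w = chartMetric p₀ y u w := rfl

lemma metricCLM_comm (p₀ : M) (y u w : E) : metricCLM p₀ y u w = metricCLM p₀ y w u := by
  rw [metricCLM_apply, metricCLM_apply, chartMetric, chartMetric, real_inner_comm]

lemma metricCLM_chart {p₀ p : M} (h : p ∈ (chartAt E p₀).source) (u w : E) :
    metricCLM p₀ (extChartAt 𝓘(ℝ, E) p₀ p) u w = inner ℝ (ofCoord p₀ p u) (ofCoord p₀ p w) := by
  rw [metricCLM_apply, chartMetric, chart_left_inv h]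

lemma metricCLM_toCoord {p₀ p : M} (h : p ∈ (chartAt E p₀).source)
    (u w : TangentSpace 𝓘(ℝ, E) p) :
    metricCLM p₀ (extChartAt 𝓘(ℝ, E) p₀ p) (toCoord p₀ p u) (toCoord p₀ p w) = inner ℝ u w := by
  rw [metricCLM_chart h, ofCoord_toCoord h, ofCoord_toCoord h]

lemma eq_zero_of_metricCLM_self {p₀ : M} {y : E} (hy : y ∈ (extChartAt 𝓘(ℝ, E) p₀).target) {u : E}
    (h : metricCLM p₀ y u u = 0) : u = 0 := by
  have h1 : ofCoord p₀ ((extChartAt 𝓘(ℝ, E) p₀).symm y) u = 0 := inner_self_eq_zero.1 h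
  have := toCoord_ofCoord (chart_symm_mem hy) u
  rw [h1, map_zero] at this
  exact this.symm

lemma metricCLM_injective {p₀ : M} {y : E} (hy : y ∈ (extChartAt 𝓘(ℝ, E) p₀).target) :
    Function.Injective (metricCLM p₀ y) := by
  rw [injective_iff_map_eq_zero]
  intro u hu
  exact eq_zero_of_metricCLM_self hy (by rw [hu]; rfl)

variable [IsContMDiffRiemannianBundle 𝓘(ℝ, E) ∞ E (fun x : M ↦ TangentSpace 𝓘(ℝ, E) x)]

lemma contDiffOn_chartMetric (p₀ : M) (u w : E) :
    ContDiffOn ℝ ∞ (fun y ↦ chartMetric p₀ y u w) (extChartAt 𝓘(ℝ, E) p₀).target := by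
  rw [← contMDiffOn_iff_contDiffOn]
  have key : ∀ u : E, ContMDiffOn 𝓘(ℝ, E) (𝓘(ℝ, E).prod 𝓘(ℝ, E)) ∞
      (fun y ↦ (⟨(extChartAt 𝓘(ℝ, E) p₀).symm y, ofCoord p₀ ((extChartAt 𝓘(ℝ, E) p₀).symm y) u⟩ :
        TotalSpace E (TangentSpace 𝓘(ℝ, E) : M → Type _))) (extChartAt 𝓘(ℝ, E) p₀).target := by
    intro u
    set e := trivializationAt E (TangentSpace 𝓘(ℝ, E) : M → Type _) p₀
    have h1 : ContMDiffOn (𝓘(ℝ, E).prod 𝓘(ℝ, E)) (𝓘(ℝ, E).prod 𝓘(ℝ, E)) ∞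
      e.toOpenPartialHomeomorph.symm e.target := Trivialization.contMDiffOn_symm e
    have h2 : ContMDiffOn 𝓘(ℝ, E) (𝓘(ℝ, E).prod 𝓘(ℝ, E)) ∞
        (fun y ↦ ((extChartAt 𝓘(ℝ, E) p₀).symm y, u)) (extChartAt 𝓘(ℝ, E) p₀).target :=
      (contMDiffOn_extChartAt_symm p₀).prodMk contMDiffOn_const
    have h3 : ∀ y ∈ (extChartAt 𝓘(ℝ, E) p₀).target,
        ((extChartAt 𝓘(ℝ, E) p₀).symm y, u) ∈ e.target := by
      intro y hy
      rw [e.mem_target]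
      exact chart_symm_mem hy
    refine (h1.comp h2 h3).congr fun y hy ↦ ?_
    rw [Function.comp_apply]
    rw [← Trivialization.mk_symm e (chart_symm_mem hy) u]
    exact congrArg (TotalSpace.mk _) (Trivialization.symmL_apply (R := ℝ) e (chart_symm_mem hy) u)
  exact ContMDiffOn.inner_bundle (E := fun x : M ↦ TangentSpace 𝓘(ℝ, E) x) (key u) (key w)

variable [FiniteDimensional ℝ E]

lemma contDiffOn_metricCLM (p₀ : M) :
    ContDiffOn ℝ ∞ (metricCLM p₀) (extChartAt 𝓘(ℝ, E) p₀).target := by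
  rw [contDiffOn_clm_apply]
  intro u
  rw [contDiffOn_clm_apply]
  intro w
  exact contDiffOn_chartMetric p₀ u w

lemma metricCLM_contDiffAt {p₀ : M} {y : E} (hy : y ∈ (extChartAt 𝓘(ℝ, E) p₀).target) :
    ContDiffAt ℝ ∞ (metricCLM p₀) y :=
  (contDiffOn_metricCLM p₀).contDiffAt ((isOpen_extChartAt_target p₀).mem_nhds hy)

/-- The Christoffel symbols in the chart at `p₀` as a continuous bilinear map. -/
def christoffelCLM (p₀ : M) (y : E) : E →L[ℝ] E →L[ℝ] E := christoffelOf (metricCLM p₀) y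

lemma metricCLM_christoffelCLM {p₀ : M} {y : E} (hy : y ∈ (extChartAt 𝓘(ℝ, E) p₀).target)
    (u v w : E) :
    metricCLM p₀ y (christoffelCLM p₀ y u v) w =
      (fderiv ℝ (metricCLM p₀) y u v w + fderiv ℝ (metricCLM p₀) y v u w
      - fderiv ℝ (metricCLM p₀) y w u v) / 2 :=
  apply_christoffelOf (metricCLM_injective hy) u v w

lemma fderiv_chartMetric {p₀ : M} {y : E} (hy : y ∈ (extChartAt 𝓘(ℝ, E) p₀).target) (u v w : E) :
    fderiv ℝ (fun q ↦ chartMetric p₀ q v w) y u = fderiv ℝ (metricCLM p₀) y u v w :=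
  fderiv_apply_apply ((metricCLM_contDiffAt hy).differentiableAt (by simp)) u v w

lemma fderiv_metricCLM_comm {p₀ : M} {y : E} (hy : y ∈ (extChartAt 𝓘(ℝ, E) p₀).target)
    (u v w : E) :
    fderiv ℝ (metricCLM p₀) y u v w = fderiv ℝ (metricCLM p₀) y u w v := by
  rw [← fderiv_chartMetric hy, ← fderiv_chartMetric hy]
  simp only [← metricCLM_apply]
  congr 2
  ext q
  exact metricCLM_comm _ _ _ _

/-- Existence and uniqueness in the defining property of the Christoffel symbols. -/
lemma christoffel_eq {p₀ : M} {y : E} (hy : y ∈ (extChartAt 𝓘(ℝ, E) p₀).target) (u v : E) :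
    christoffel p₀ y u v = christoffelCLM p₀ y u v := by
  have key : ∀ w, chartMetric p₀ y (christoffelCLM p₀ y u v) w =
      (fderiv ℝ (fun q ↦ chartMetric p₀ q v w) y u + fderiv ℝ (fun q ↦ chartMetric p₀ q u w) y v
      - fderiv ℝ (fun q ↦ chartMetric p₀ q u v) y w) / 2 := by
    intro w
    rw [fderiv_chartMetric hy, fderiv_chartMetric hy, fderiv_chartMetric hy,
      ← metricCLM_christoffelCLM hy, metricCLM_apply]
  have h2 := Classical.epsilon_spec (p := fun z : E ↦ ∀ w : E, chartMetric p₀ y z w =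
    (fderiv ℝ (fun q ↦ chartMetric p₀ q v w) y u + fderiv ℝ (fun q ↦ chartMetric p₀ q u w) y v
      - fderiv ℝ (fun q ↦ chartMetric p₀ q u v) y w) / 2) ⟨_, key⟩
  apply metricCLM_injective hy
  ext w
  rw [metricCLM_apply, metricCLM_apply, key w]
  exact h2 w

lemma christoffelCLM_comm {p₀ : M} {y : E} (hy : y ∈ (extChartAt 𝓘(ℝ, E) p₀).target) (u v : E) :
    christoffelCLM p₀ y u v = christoffelCLM p₀ y v u := by
  apply metricCLM_injective hy
  ext w
  rw [metricCLM_christoffelCLM hy, metricCLM_christoffelCLM hy, fderiv_metricCLM_comm hy w u v]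
  ring

lemma christoffelCLM_contDiffAt {p₀ : M} {y : E} (hy : y ∈ (extChartAt 𝓘(ℝ, E) p₀).target) :
    ContDiffAt ℝ ∞ (christoffelCLM p₀) y :=
  contDiffAt_christoffelOf (metricCLM_injective hy) (metricCLM_contDiffAt hy)

end Metric

/-! ### Superposition operators on spaces of continuous functions -/

section Superposition

universe u

variable {K : Type*} [TopologicalSpace K] [CompactSpace K]

/-- Pointwise application of a continuous family of linear maps to a continuous function. -/
def applyCLM (K : Type*) [TopologicalSpace K] [CompactSpace K]
    (E F : Type*) [NormedAddCommGroup E] [NormedSpace ℝ E] [NormedAddCommGroup F]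
    [NormedSpace ℝ F] : C(K, E →L[ℝ] F) →L[ℝ] C(K, E) →L[ℝ] C(K, F) :=
  LinearMap.mkContinuous₂
    (LinearMap.mk₂ ℝ (fun A h ↦ (⟨fun t ↦ A t (h t), by fun_prop⟩ : C(K, F)))
      (by intros; ext; simp) (by intros; ext; simp) (by intros; ext; simp) (by intros; ext; simp))
    1 (by
      intro A h
      rw [one_mul, ContinuousMap.norm_le _ (by positivity)]
      intro t
      exact (A t).le_of_opNorm_le_of_le (A.norm_coe_le_norm t) (h.norm_coe_le_norm t))

variable {E : Type u} [NormedAddCommGroup E] [NormedSpace ℝ E]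

/-- The superposition operator `c ↦ G ∘ c` of a `C¹` map is differentiable: on the compact range
of `c` the derivative of `G` is uniformly continuous. -/
lemma hasFDerivAt_superposition {F : Type*} [NormedAddCommGroup F] [NormedSpace ℝ F]
    (G : C(E, F)) (DG : C(E, E →L[ℝ] F)) (hG : ∀ x, HasFDerivAt G (DG x) x) (c : C(K, E)) :
    HasFDerivAt (fun c : C(K, E) ↦ G.comp c) (applyCLM K E F (DG.comp c)) c := by
  rw [hasFDerivAt_iff_isLittleO_nhds_zero, Asymptotics.isLittleO_iff]
  intro ε hε
  have hcomp : IsCompact (range c) := isCompact_range c.continuous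
  have hu := hcomp.uniformContinuousAt_of_continuousAt DG
    (fun a _ ↦ DG.continuous.continuousAt) (Metric.dist_mem_uniformity hε)
  obtain ⟨δ, hδ, hu⟩ := Metric.mem_uniformity_dist.1 hu
  filter_upwards [Metric.ball_mem_nhds (0 : C(K, E)) hδ] with h hh
  rw [mem_ball_zero_iff] at hh
  rw [ContinuousMap.norm_le _ (by positivity)]
  intro t
  have hht : ‖h t‖ ≤ ‖h‖ := h.norm_coe_le_norm t
  have hm := (convex_ball (c t) δ).norm_image_sub_le_of_norm_hasFDerivWithin_le'
    (f := G) (f' := DG) (φ := DG (c t)) (C := ε) (x := c t) (y := c t + h t)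
    (fun x _ ↦ (hG x).hasFDerivWithinAt)
    (fun x hx ↦ by
      have := @hu (c t) x (by rw [dist_comm]; exact hx) ⟨t, rfl⟩
      rw [← dist_eq_norm, dist_comm]
      exact le_of_lt this)
    (Metric.mem_ball_self hδ) (by simpa using hht.trans_lt hh)
  simp only [add_sub_cancel_left] at hm
  exact hm.trans (by gcongr)

/-- The superposition operator of a `Cⁿ` map is `Cⁿ` on the space of continuous functions. -/
lemma contDiff_superposition (n : ℕ) :
    ∀ {F : Type u} [NormedAddCommGroup F] [NormedSpace ℝ F] (G : C(E, F)), ContDiff ℝ n G →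
      ContDiff ℝ n (fun c : C(K, E) ↦ G.comp c) := by
  induction n with
  | zero =>
    intro F _ _ G _
    exact contDiff_zero.2 G.continuous_postcomp
  | succ n ih =>
    intro F _ _ G hG
    push_cast at hG ⊢
    obtain ⟨DG, hDG, hd⟩ := contDiff_succ_iff_hasFDerivAt.1 hG
    let D : C(E, E →L[ℝ] F) := ⟨DG, hDG.continuous⟩
    exact contDiff_succ_iff_hasFDerivAt.2 ⟨fun c ↦ applyCLM K E F (D.comp c),
      (applyCLM K E F).contDiff.comp (ih D hDG), hasFDerivAt_superposition G D hd⟩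

end Superposition

/-! ### Smooth dependence of geodesics on the initial velocity -/

section LocalExp

variable {E : Type*} [NormedAddCommGroup E] [NormedSpace ℝ E]

/-- The time interval on which geodesics are constructed: it is a neighbourhood of `[0, 1]`. -/
abbrev TimeInterval : Set ℝ := Icc (-2) 2

lemma neg_two_le_two : (-2 : ℝ) ≤ 2 := by norm_num

/-- The primitive vanishing at `0` of a function on `TimeInterval`, extended by constants. -/
def primitive (w : C(TimeInterval, E)) (t : ℝ) : E := ∫ τ in (0 : ℝ)..t, IccExtend neg_two_le_two w τ

lemma continuous_IccExtend (w : C(TimeInterval, E)) : Continuous (IccExtend neg_two_le_two w) :=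
  w.continuous.Icc_extend'

lemma norm_primitive_le (w : C(TimeInterval, E)) (t : TimeInterval) : ‖primitive w t‖ ≤ 2 * ‖w‖ := by
  have h := intervalIntegral.norm_integral_le_of_norm_le_const (a := 0) (b := (t : ℝ))
    (f := IccExtend neg_two_le_two w) (C := ‖w‖) (fun x _ ↦ w.norm_coe_le_norm _)
  have h2 : |(t : ℝ) - 0| ≤ 2 := by
    rw [sub_zero, abs_le]
    exact t.2
  refine h.trans ?_
  rw [mul_comm]
  gcongr

variable [CompleteSpace E]

lemma hasDerivAt_primitive (w : C(TimeInterval, E)) (t : ℝ) :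
    HasDerivAt (primitive w) (IccExtend neg_two_le_two w t) t :=
  ((continuous_IccExtend w).integral_hasStrictDerivAt 0 t).hasDerivAt

/-- The operator `w ↦ ∫₀ᵗ w` on continuous functions. -/
def primitiveCLM (E : Type*) [NormedAddCommGroup E] [NormedSpace ℝ E] [CompleteSpace E] :
    C(TimeInterval, E) →L[ℝ] C(TimeInterval, E) :=
  LinearMap.mkContinuous
    { toFun := fun w ↦ ⟨fun t ↦ primitive w t, by
        have : Continuous (primitive w) :=
          continuous_iff_continuousAt.2 fun t ↦ (hasDerivAt_primitive w t).continuousAt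
        fun_prop⟩
      map_add' := by
        intro v w
        ext t
        exact intervalIntegral.integral_add ((continuous_IccExtend v).intervalIntegrable _ _)
          ((continuous_IccExtend w).intervalIntegrable _ _)
      map_smul' := by
        intro a w
        ext t
        exact intervalIntegral.integral_smul a (IccExtend neg_two_le_two w) }
    2 (by
      intro w
      rw [ContinuousMap.norm_le _ (by positivity)]
      exact norm_primitive_le w)

/-- A map which is smooth near a point agrees near that point with a globally smooth map. -/
lemma exists_contDiff_eventuallyEq {E F : Type*} [NormedAddCommGroup E] [NormedSpace ℝ E]
    [FiniteDimensional ℝ E] [NormedAddCommGroup F] [NormedSpace ℝ F] {n : ℕ∞} {f : E → F} {x : E}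
    {U : Set E} (hU : IsOpen U) (hx : x ∈ U) (hf : ∀ y ∈ U, ContDiffAt ℝ n f y) :
    ∃ g : E → F, ContDiff ℝ n g ∧ g =ᶠ[𝓝 x] f := by
  obtain ⟨r, hr, hrU⟩ := Metric.isOpen_iff.1 hU x hx
  let χ : ContDiffBump x := ⟨r / 4, r / 2, by linarith, by linarith⟩
  refine ⟨fun y ↦ χ y • f y, ?_, ?_⟩
  · rw [contDiff_iff_contDiffAt]
    intro y
    by_cases hy : y ∈ U
    · exact χ.contDiffAt.smul (hf y hy)
    · have hy2 : y ∉ tsupport χ := by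
        rw [χ.tsupport_eq]
        intro h
        refine hy (hrU (Metric.closedBall_subset_ball ?_ h))
        change r / 2 < r
        linarith
      have h0 : (fun y ↦ χ y • f y) =ᶠ[𝓝 y] fun _ ↦ 0 := by
        filter_upwards [notMem_tsupport_iff_eventuallyEq.1 hy2] with z hz
        rw [hz, Pi.zero_apply, zero_smul]
      exact contDiffAt_const.congr_of_eventuallyEq h0
  · filter_upwards [χ.eventuallyEq_one] with y hy
    rw [hy, Pi.one_apply, one_smul]

/-- Smooth dependence of geodesics on their initial velocity.  The velocity `w` of a geodesic from
`y₀` solves the fixed point equation `w(t) + ∫₀ᵗ Γ(w, w) = v` along the curve `y₀ + ∫₀ᵗ w`; its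
left-hand side is a `C²` function of `w` in a space of continuous functions, whose derivative at
`w = 0` is the identity since `Γ(w, w)` is quadratic, and the inverse function theorem applies. -/
lemma exists_local_exp [FiniteDimensional ℝ E] {Γ : E → E →L[ℝ] E →L[ℝ] E} {y₀ : E}
    {U : Set E} (hU : IsOpen U) (hy₀ : y₀ ∈ U) (hΓ : ∀ y ∈ U, ContDiffAt ℝ ∞ Γ y) :
    ∃ φ : E → E, ContDiffAt ℝ 2 φ 0 ∧ ∀ᶠ v in 𝓝 (0 : E), ∃ c w : ℝ → E,
      c 0 = y₀ ∧ w 0 = v ∧ c 1 = φ v ∧ ∀ t ∈ Ioo (-2 : ℝ) 2,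
        c t ∈ U ∧ HasDerivAt c (w t) t ∧ HasDerivAt w (-Γ (c t) (w t) (w t)) t := by
  obtain ⟨Γ', hΓ', hΓeq⟩ := exists_contDiff_eventuallyEq hU hy₀ hΓ
  let G : C(E × E, E) := ⟨fun p ↦ Γ' p.1 p.2 p.2, by
    have := hΓ'.continuous
    fun_prop⟩
  have hG : ContDiff ℝ 2 G := by
    have h1 : ContDiff ℝ 2 (fun p : E × E ↦ Γ' p.1) :=
      (contDiff_infty.1 hΓ' 2).comp contDiff_fst
    exact (h1.clm_apply contDiff_snd).clm_apply contDiff_snd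
  have hDG0 : HasFDerivAt G (0 : E × E →L[ℝ] E) (y₀, 0) := by
    have h1 : HasFDerivAt (fun p : E × E ↦ Γ' p.1) _ (y₀, 0) :=
      ((hΓ'.differentiable (by simp)).differentiableAt.hasFDerivAt (x := y₀)).comp (y₀, (0 : E))
        hasFDerivAt_fst
    have h2 := (h1.clm_apply hasFDerivAt_snd).clm_apply hasFDerivAt_snd
    refine h2.congr_fderiv ?_
    ext <;> simp
  let DG : C(E × E, E × E →L[ℝ] E) := ⟨fderiv ℝ G, hG.continuous_fderiv (by simp)⟩
  have hDG : ∀ p, HasFDerivAt G (DG p) p := fun p ↦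
    ((hG.differentiable (by simp)) p).hasFDerivAt
  let Λ : C(TimeInterval, E) →L[ℝ] C(TimeInterval, E × E) :=
    (ContinuousLinearMap.compLeftContinuous ℝ TimeInterval (ContinuousLinearMap.inl ℝ E E)) ∘L
      primitiveCLM E +
    ContinuousLinearMap.compLeftContinuous ℝ TimeInterval (ContinuousLinearMap.inr ℝ E E)
  let pair : C(TimeInterval, E) → C(TimeInterval, E × E) := fun w ↦
    ContinuousMap.const _ (y₀, 0) + Λ w
  have hpair : ∀ w t, pair w t = (y₀ + primitive w t, w t) := by
    intro w t
    simp only [pair, Λ, ContinuousMap.add_apply, ContinuousMap.const_apply,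
      add_apply]
    change (y₀, (0 : E)) + ((primitive w t, (0 : E)) + ((0 : E), w t)) = _
    simp
  let Ψ : C(TimeInterval, E) → C(TimeInterval, E) := fun w ↦ w + primitiveCLM E (G.comp (pair w))
  have hpairC : ContDiff ℝ 2 pair := contDiff_const.add Λ.contDiff
  have hΨ : ContDiff ℝ 2 Ψ :=
    contDiff_id.add ((primitiveCLM E).contDiff.comp
      ((contDiff_superposition 2 G (by exact_mod_cast hG)).comp hpairC))
  have hpair0 : pair 0 = ContinuousMap.const _ (y₀, 0) := by simp [pair]
  have hΨ' : HasFDerivAt Ψ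
      ((ContinuousLinearEquiv.refl ℝ C(TimeInterval, E) :) : _ →L[ℝ] C(TimeInterval, E)) 0 := by
    have h1 : HasFDerivAt pair Λ 0 := (Λ.hasFDerivAt (x := 0)).const_add _
    have h2 := (hasFDerivAt_superposition G DG hDG (pair 0)).comp 0 h1
    have h3 := (hasFDerivAt_id (𝕜 := ℝ) (0 : C(TimeInterval, E))).add
      ((primitiveCLM E).hasFDerivAt.comp 0 h2)
    refine h3.congr_fderiv ?_
    have h4 : DG.comp (pair 0) = 0 := by
      ext1 t
      rw [hpair0]
      exact hDG0.fderiv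
    rw [h4]
    ext w t
    simp
  have hΨ0 : Ψ 0 = 0 := by
    have : G.comp (pair 0) = 0 := by
      ext t
      rw [hpair0]
      simp [G]
    simp only [Ψ, this, map_zero, add_zero]
  have hΨa : ContDiffAt ℝ 2 Ψ 0 := hΨ.contDiffAt
  have hst := hΨa.hasStrictFDerivAt' hΨ' (by simp)
  let W := hΨa.localInverse hΨ' (by simp)
  have hW : ContDiffAt ℝ 2 W 0 := by
    have := hΨa.to_localInverse hΨ' (by simp)
    rwa [hΨ0] at this
  have hW0 : W 0 = 0 := by
    have := hst.localInverse_apply_image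
    rwa [hΨ0] at this
  have hWr : ∀ᶠ u in 𝓝 (0 : C(TimeInterval, E)), Ψ (W u) = u := by
    have := hst.eventually_right_inverse
    rwa [hΨ0] at this
  let cst := ContinuousLinearMap.const ℝ (M := E) TimeInterval
  let one : TimeInterval := ⟨1, by norm_num, by norm_num⟩
  have hcst : Tendsto cst (𝓝 0) (𝓝 0) := by
    have := cst.continuous.tendsto 0
    rwa [map_zero] at this
  have hWcst : ContDiffAt ℝ 2 (fun v ↦ W (cst v)) 0 := by
    refine ContDiffAt.comp 0 ?_ cst.contDiff.contDiffAt
    rwa [map_zero]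
  refine ⟨fun v ↦ y₀ + primitiveCLM E (W (cst v)) one, ?_, ?_⟩
  · let ev : C(TimeInterval, E) →L[ℝ] E := (ContinuousMap.evalCLM ℝ one) ∘L primitiveCLM E
    have hev : ContDiffAt ℝ 2 (fun v ↦ ev (W (cst v))) 0 := ev.contDiff.contDiffAt.comp 0 hWcst
    exact contDiffAt_const.add hev
  · obtain ⟨r, hr, hrU⟩ := Metric.eventually_nhds_iff.1 (hΓeq.and (hU.mem_nhds hy₀))
    have hsmall : ∀ᶠ v in 𝓝 (0 : E), ‖W (cst v)‖ < r / 2 := by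
      have h1 : Tendsto (fun v ↦ W (cst v)) (𝓝 0) (𝓝 (W (cst 0))) := hWcst.continuousAt
      rw [map_zero, hW0] at h1
      have h2 := h1.norm
      rw [norm_zero] at h2
      exact h2.eventually_lt_const (by linarith)
    filter_upwards [hsmall, hcst.eventually hWr] with v hv1 hv2
    set ξ := W (cst v) with hξ
    have hξt : ∀ t : TimeInterval, ξ t = v - primitive (G.comp (pair ξ)) t := by
      intro t
      have := congrArg (fun f : C(TimeInterval, E) ↦ f t) hv2
      exact eq_sub_of_add_eq this
    refine ⟨fun t ↦ y₀ + primitive ξ t, fun t ↦ v - primitive (G.comp (pair ξ)) t, ?_, ?_, rfl, ?_⟩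
    · simp [primitive]
    · simp [primitive]
    · intro t ht
      have htI : t ∈ TimeInterval := Ioo_subset_Icc_self ht
      have hball : dist (y₀ + primitive ξ t) y₀ < r := by
        rw [dist_eq_norm, add_sub_cancel_left]
        have := norm_primitive_le ξ ⟨t, htI⟩
        simp only at this
        linarith
      have hΓt := (hrU hball).1
      refine ⟨(hrU hball).2, ?_, ?_⟩
      · have h1 := (hasDerivAt_primitive ξ t).const_add y₀
        rw [IccExtend_of_mem _ _ htI, hξt] at h1
        exact h1
      · have h1 := (hasDerivAt_primitive (G.comp (pair ξ)) t).const_sub v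
        rw [IccExtend_of_mem _ _ htI] at h1
        have h2 : (G.comp (pair ξ)) ⟨t, htI⟩ = Γ (y₀ + primitive ξ t)
            (v - primitive (G.comp (pair ξ)) t) (v - primitive (G.comp (pair ξ)) t) := by
          rw [ContinuousMap.comp_apply, hpair, hξt, ← hΓt]
          rfl
        rw [h2] at h1
        exact h1

end LocalExp

/-! ### The gradient of the cubic model -/

section CubicModel

variable {V : Type*} [NormedAddCommGroup V] [InnerProductSpace ℝ V] [CompleteSpace V]

/-- The Riesz isomorphism from the dual of a real Hilbert space, as a linear map. -/
def rieszCLM (V : Type*) [NormedAddCommGroup V] [InnerProductSpace ℝ V] [CompleteSpace V] :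
    (V →L[ℝ] ℝ) →L[ℝ] V :=
  LinearMap.mkContinuous
    { toFun := fun l ↦ (InnerProductSpace.toDual ℝ V).symm l
      map_add' := by simp
      map_smul' := by simp } 1 (by simp)

lemma hasFDerivAt_gradient {h : V → ℝ} {y : V} (hh : ContDiffAt ℝ 2 h y) :
    HasFDerivAt (gradient h)
      (rieszCLM V ∘L fderiv ℝ (fderiv ℝ h) y) y := by
  have h1 : DifferentiableAt ℝ (fderiv ℝ h) y :=
    (hh.fderiv_right (m := 1) (by norm_num)).differentiableAt (by simp)
  exact (rieszCLM V).hasFDerivAt.comp y h1.hasFDerivAt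

lemma inner_gradient_left {h : V → ℝ} {y w : V} : inner ℝ (gradient h y) w = fderiv ℝ h y w :=
  InnerProductSpace.toDual_symm_apply

lemma inner_fderiv_gradient {h : V → ℝ} {y : V} (hh : ContDiffAt ℝ 2 h y) (s w : V) :
    inner ℝ (fderiv ℝ (gradient h) y s) w = fderiv ℝ (fderiv ℝ h) y s w := by
  rw [(hasFDerivAt_gradient hh).fderiv]
  exact InnerProductSpace.toDual_symm_apply

/-- The gradient of the regularized model.  The Hessian is symmetric since `h` is `C²`. -/
lemma gradient_cubicModel {h : V → ℝ} (hh : ContDiffAt ℝ 2 h 0) (ς : ℝ) (s : V) :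
    gradient (cubicModel h ς) s
      = gradient h 0 + fderiv ℝ (gradient h) 0 s + (ς * ‖s‖) • s := by
  apply HasGradientAt.gradient
  rw [hasGradientAt_iff_hasFDerivAt]
  set H := fderiv ℝ (gradient h) 0 with hH
  have hsymm : ∀ u w, inner ℝ (H u) w = inner ℝ u (H w) := by
    intro u w
    rw [real_inner_comm (H w) u, inner_fderiv_gradient hh, inner_fderiv_gradient hh]
    exact (hh.isSymmSndFDerivAt (by simp)).eq u w
  have h1 : HasFDerivAt (fun s : V ↦ inner ℝ s (gradient h 0)) _ s :=
    (hasFDerivAt_id s).inner ℝ (hasFDerivAt_const (gradient h 0) s)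
  have h2 : HasFDerivAt (fun s : V ↦ inner ℝ s (H s)) _ s :=
    (hasFDerivAt_id s).inner ℝ H.hasFDerivAt
  have h3 : HasFDerivAt (fun s : V ↦ ‖s‖ ^ 3) ((3 * ‖s‖) • innerSL ℝ s) s := by
    have := hasFDerivAt_norm_rpow s (p := 3) (by norm_num)
    norm_num at this
    exact_mod_cast this
  have h4 := ((h1.const_add (h 0)).add (h2.const_mul (1 / 2))).add (h3.const_mul (ς / 3))
  refine h4.congr_fderiv ?_
  ext w
  simp
  rw [← hsymm, real_inner_comm w (H s)]
  ring

end CubicModel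

/-! ### Geodesics and the exponential map -/

section Geodesics

variable {E : Type*} [NormedAddCommGroup E] [NormedSpace ℝ E] [FiniteDimensional ℝ E]
  {M : Type*} [TopologicalSpace M] [ChartedSpace E M] [IsManifold 𝓘(ℝ, E) ∞ M]
  [RiemannianBundle (fun x : M ↦ TangentSpace 𝓘(ℝ, E) x)]

/-- The coordinates of a curve in the chart at `p₀`. -/
def coordCurve (p₀ : M) (γ : ℝ → M) (τ : ℝ) : E := extChartAt 𝓘(ℝ, E) p₀ (γ τ)

/-- Near the time `t` the curve `γ` solves the geodesic equation in the chart at `p₀`. -/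
def IsGeodesicAt (p₀ : M) (γ : ℝ → M) (t : ℝ) : Prop :=
  ContinuousAt γ t ∧ γ t ∈ (chartAt E p₀).source ∧ ∀ᶠ τ in 𝓝 t,
    DifferentiableAt ℝ (coordCurve (E := E) p₀ γ) τ ∧
    HasDerivAt (deriv (coordCurve (E := E) p₀ γ))
      (-christoffelCLM p₀ (coordCurve p₀ γ τ) (deriv (coordCurve p₀ γ) τ)
        (deriv (coordCurve p₀ γ) τ)) τ

lemma eventually_mem_source {p₀ : M} {γ : ℝ → M} {t : ℝ} (hc : ContinuousAt γ t)
    (h : γ t ∈ (chartAt E p₀).source) : ∀ᶠ τ in 𝓝 t, γ τ ∈ (chartAt E p₀).source :=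
  hc.eventually ((chartAt E p₀).open_source.mem_nhds h)

lemma contDiffAt_coordCurve {p₀ : M} {γ : ℝ → M} {t : ℝ}
    (hγ : ContMDiff 𝓘(ℝ, ℝ) 𝓘(ℝ, E) ∞ γ) (h : γ t ∈ (chartAt E p₀).source) :
    ContDiffAt ℝ ∞ (coordCurve (E := E) p₀ γ) t := by
  rw [← contMDiffAt_iff_contDiffAt]
  exact ContMDiffAt.comp t (contMDiffAt_extChartAt' h) hγ.contMDiffAt

lemma toCoord_velocity_eq_deriv {p₀ : M} {γ : ℝ → M} {t : ℝ}
    (hγ : ContMDiff 𝓘(ℝ, ℝ) 𝓘(ℝ, E) ∞ γ) (h : γ t ∈ (chartAt E p₀).source) :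
    toCoord p₀ (γ t) (velocity γ t) = deriv (coordCurve (E := E) p₀ γ) t :=
  toCoord_velocity h (hγ.mdifferentiableAt (by simp))

lemma coordCurve_eventuallyEq_comp {p₀ q : M} {γ : ℝ → M} {t : ℝ}
    (hc : ContinuousAt γ t) (hq : γ t ∈ (chartAt E q).source) :
    coordCurve (E := E) p₀ γ =ᶠ[𝓝 t]
      (extChartAt 𝓘(ℝ, E) p₀ ∘ (extChartAt 𝓘(ℝ, E) q).symm) ∘ coordCurve (E := E) q γ := by
  filter_upwards [eventually_mem_source hc hq] with τ hτ
  simp only [coordCurve, Function.comp_apply]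
  rw [chart_left_inv hτ]

lemma IsGeodesicAt.comp_mul {p₀ : M} {γ : ℝ → M} {a t : ℝ}
    (h : IsGeodesicAt (E := E) p₀ γ (a * t)) :
    IsGeodesicAt (E := E) p₀ (fun τ ↦ γ (a * τ)) t := by
  obtain ⟨hc, hs, he⟩ := h
  have hmul : Tendsto (fun τ : ℝ ↦ a * τ) (𝓝 t) (𝓝 (a * t)) := (continuous_const_mul a).tendsto t
  refine ⟨ContinuousAt.comp (f := fun τ : ℝ ↦ a * τ) hc hmul, hs, ?_⟩
  have hd : ∀ τ, DifferentiableAt ℝ (coordCurve (E := E) p₀ γ) (a * τ) →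
      HasDerivAt (coordCurve (E := E) p₀ (fun τ ↦ γ (a * τ)))
        (a • deriv (coordCurve (E := E) p₀ γ) (a * τ)) τ := by
    intro τ hτ
    have h1 : HasDerivAt (fun τ : ℝ ↦ a * τ) a τ := by simpa using (hasDerivAt_id τ).const_mul a
    exact hτ.hasDerivAt.scomp τ h1
  have he' := eventually_eventually_nhds.2 (hmul.eventually he)
  filter_upwards [he'] with τ hτ
  have hτ0 := hτ.self_of_nhds
  refine ⟨(hd τ hτ0.1).differentiableAt, ?_⟩
  have h2 : deriv (coordCurve (E := E) p₀ (fun τ ↦ γ (a * τ))) =ᶠ[𝓝 τ]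
      fun τ ↦ a • deriv (coordCurve (E := E) p₀ γ) (a * τ) := by
    filter_upwards [hτ] with σ hσ
    exact (hd σ hσ.1).deriv
  have h1 : HasDerivAt (fun τ : ℝ ↦ a * τ) a τ := by simpa using (hasDerivAt_id τ).const_mul a
  have h3 := (hτ0.2.scomp τ h1).const_smul a
  rw [h2.self_of_nhds]
  refine (h3.congr_of_eventuallyEq h2).congr_deriv ?_
  simp only [map_smul, smul_apply, smul_neg]
  rfl

variable [IsContMDiffRiemannianBundle 𝓘(ℝ, E) ∞ E (fun x : M ↦ TangentSpace 𝓘(ℝ, E) x)]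

lemma IsGeodesic.isGeodesicAt {γ : ℝ → M} (hγ : IsGeodesic (E := E) γ) {t : ℝ} {p₀ : M}
    (h : γ t ∈ (chartAt E p₀).source) : IsGeodesicAt (E := E) p₀ γ t := by
  have hc : Continuous γ := hγ.1.continuous
  refine ⟨hc.continuousAt, h, ?_⟩
  filter_upwards [eventually_mem_source hc.continuousAt h] with τ hτ
  refine ⟨(contDiffAt_coordCurve hγ.1 hτ).differentiableAt (by simp), ?_⟩
  have h1 := hγ.2 p₀ τ (mem_univ τ) hτ
  rw [hasDerivWithinAt_univ, christoffel_eq (chart_mem hτ), toCoord_velocity_eq_deriv hγ.1 hτ] at h1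
  refine h1.congr_of_eventuallyEq ?_
  filter_upwards [eventually_mem_source hc.continuousAt hτ] with σ hσ
  exact (toCoord_velocity_eq_deriv hγ.1 hσ).symm

/-- Local uniqueness of geodesics with given position and velocity. -/
lemma IsGeodesicAt.eventuallyEq {p₀ : M} {γ₁ γ₂ : ℝ → M} {t : ℝ}
    (h₁ : IsGeodesicAt (E := E) p₀ γ₁ t) (h₂ : IsGeodesicAt (E := E) p₀ γ₂ t)
    (h : γ₁ t = γ₂ t)
    (hd : deriv (coordCurve (E := E) p₀ γ₁) t = deriv (coordCurve (E := E) p₀ γ₂) t) :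
    γ₁ =ᶠ[𝓝 t] γ₂ := by
  -- the geodesic equation as a first order system
  let v : E × E → E × E := fun p ↦ (p.2, -christoffelCLM p₀ p.1 p.2 p.2)
  let Y : (ℝ → M) → ℝ → E × E := fun γ τ ↦ (coordCurve p₀ γ τ, deriv (coordCurve p₀ γ) τ)
  have hv : ContDiffAt ℝ 1 v (Y γ₁ t) := by
    have h0 : ContDiffAt ℝ 1 (christoffelCLM p₀) (Y γ₁ t).1 :=
      (christoffelCLM_contDiffAt (chart_mem h₁.2.1)).of_le (by simp)
    have h1 : ContDiffAt ℝ 1 (fun p : E × E ↦ christoffelCLM p₀ p.1) (Y γ₁ t) :=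
      h0.comp _ contDiffAt_fst
    exact contDiffAt_snd.prodMk ((h1.clm_apply contDiffAt_snd).clm_apply contDiffAt_snd).neg
  obtain ⟨K, s, hs, hK⟩ := hv.exists_lipschitzOnWith
  have key : ∀ γ, IsGeodesicAt (E := E) p₀ γ t → Y γ t = Y γ₁ t →
      ∀ᶠ τ in 𝓝 t, HasDerivAt (Y γ) (v (Y γ τ)) τ ∧ Y γ τ ∈ s := by
    intro γ hγ hY
    have hder : ∀ᶠ τ in 𝓝 t, HasDerivAt (Y γ) (v (Y γ τ)) τ := by
      filter_upwards [hγ.2.2] with τ hτ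
      exact hτ.1.hasDerivAt.prodMk hτ.2
    refine hder.and (hder.self_of_nhds.continuousAt.eventually ?_)
    rwa [hY]
  have hY : Y γ₁ t = Y γ₂ t := by simp only [Y, coordCurve, h, hd]
  have := ODE_solution_unique_of_eventually (v := fun _ ↦ v) (s := fun _ ↦ s)
    (Eventually.of_forall fun _ ↦ hK) (key γ₁ h₁ rfl) (key γ₂ h₂ hY.symm) hY
  filter_upwards [this, eventually_mem_source h₁.1 h₁.2.1, eventually_mem_source h₂.1 h₂.2.1]
    with τ hτ h1 h2
  have h3 : coordCurve (E := E) p₀ γ₁ τ = coordCurve p₀ γ₂ τ := congrArg Prod.fst hτ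
  rw [← chart_left_inv (E := E) h1, ← chart_left_inv (E := E) h2]
  exact congrArg _ h3

/-- Uniqueness of geodesics: the set of times near which two geodesics agree is open and closed. -/
lemma IsGeodesic.eqOn [T2Space M] {γ₁ γ₂ : ℝ → M} {J : Set ℝ} (hJ : IsPreconnected J)
    (h₁ : IsGeodesic (E := E) γ₁)
    (h₂ : ∀ t ∈ J, ∃ p₀, IsGeodesicAt (E := E) p₀ γ₂ t)
    {t₀ : ℝ} (ht₀ : t₀ ∈ J) (h0 : γ₁ =ᶠ[𝓝 t₀] γ₂) : EqOn γ₁ γ₂ J := by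
  have hsub : J ⊆ {t | γ₁ =ᶠ[𝓝 t] γ₂} := by
    refine hJ.subset_of_closure_inter_subset ?_ ⟨t₀, ht₀, h0⟩ ?_
    · rw [isOpen_iff_mem_nhds]
      exact fun t ht ↦ eventually_eventually_nhds.2 ht
    · rintro t ⟨htc, htJ⟩
      obtain ⟨p₀, hp⟩ := h₂ t htJ
      have hfr : ∃ᶠ τ in 𝓝 t, γ₁ =ᶠ[𝓝 τ] γ₂ := mem_closure_iff_frequently.1 htc
      have hc₁ : ContinuousAt γ₁ t := h₁.1.continuous.continuousAt
      have heq : γ₁ t = γ₂ t :=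
        tendsto_nhds_unique_of_frequently_eq hc₁ hp.1 (hfr.mono fun τ hτ ↦ hτ.self_of_nhds)
      have hg₁ : IsGeodesicAt (E := E) p₀ γ₁ t := h₁.isGeodesicAt (by rw [heq]; exact hp.2.1)
      refine hg₁.eventuallyEq hp heq ?_
      refine tendsto_nhds_unique_of_frequently_eq hg₁.2.2.self_of_nhds.2.continuousAt
        hp.2.2.self_of_nhds.2.continuousAt (hfr.mono fun τ hτ ↦ ?_)
      refine EventuallyEq.deriv_eq ?_
      filter_upwards [hτ] with σ hσ
      rw [coordCurve, coordCurve, hσ]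
  exact fun t ht ↦ (hsub ht).self_of_nhds

lemma IsGeodesicFrom.apply_zero {x : M} {v : TangentSpace 𝓘(ℝ, E) x} {γ : ℝ → M}
    (h : IsGeodesicFrom x v γ) : γ 0 = x := congrArg TotalSpace.proj h.2

lemma IsGeodesicFrom.toCoord_velocity {x : M} {v : TangentSpace 𝓘(ℝ, E) x} {γ : ℝ → M}
    (h : IsGeodesicFrom x v γ) (p₀ : M) :
    toCoord p₀ (γ 0) (velocity γ 0) = toCoord p₀ x v :=
  congrArg (fun p : TangentBundle 𝓘(ℝ, E) M ↦ toCoord p₀ p.1 p.2) h.2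

lemma IsGeodesicFrom.deriv_coordCurve {x : M} {v : TangentSpace 𝓘(ℝ, E) x} {γ : ℝ → M}
    (h : IsGeodesicFrom x v γ) {p₀ : M} (hx : x ∈ (chartAt E p₀).source) :
    deriv (coordCurve (E := E) p₀ γ) 0 = toCoord p₀ x v := by
  rw [← h.toCoord_velocity, toCoord_velocity_eq_deriv h.1.1]
  rwa [h.apply_zero]

lemma exists_isGeodesicFrom_one_eq_Exp (hM : IsGeodesicallyComplete E M) (x : M)
    (v : TangentSpace 𝓘(ℝ, E) x) : ∃ γ : ℝ → M, IsGeodesicFrom x v γ ∧ γ 1 = Exp x v := by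
  refine ⟨(hM x v).choose, (hM x v).choose_spec, ?_⟩
  rw [Exp, dif_pos (hM x v)]

variable [T2Space M]

/-- The exponential map along a ray is the geodesic in that direction. -/
lemma Exp_smul (hM : IsGeodesicallyComplete E M) {x : M} {v : TangentSpace 𝓘(ℝ, E) x}
    {γ : ℝ → M} (hγ : IsGeodesicFrom x v γ) (t : ℝ) : Exp x (t • v) = γ t := by
  obtain ⟨γ₁, h₁, h1⟩ := exists_isGeodesicFrom_one_eq_Exp hM x (t • v)
  have h₂ : ∀ τ, ∀ p₀ : M, γ (t * τ) ∈ (chartAt E p₀).source →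
      IsGeodesicAt (E := E) p₀ (fun τ ↦ γ (t * τ)) τ := fun τ p₀ h ↦
    (hγ.1.isGeodesicAt h).comp_mul
  have hx : γ (t * 0) = x := by rw [mul_zero, hγ.apply_zero]
  have h20 := h₂ 0 x (by rw [hx]; exact mem_chart_source E x)
  have h10 : IsGeodesicAt (E := E) x γ₁ 0 :=
    h₁.1.isGeodesicAt (by rw [h₁.apply_zero]; exact mem_chart_source E x)
  have heq := h₁.1.eqOn isPreconnected_univ
    (fun τ _ ↦ ⟨γ (t * τ), h₂ τ _ (mem_chart_source E _)⟩) (mem_univ 0)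
    (h10.eventuallyEq h20 (by rw [h₁.apply_zero, hx]) (by
      have hd : HasDerivAt (coordCurve (E := E) x γ) (toCoord x x v) (t * 0) := by
        rw [mul_zero, ← hγ.deriv_coordCurve (mem_chart_source E x)]
        refine DifferentiableAt.hasDerivAt ((contDiffAt_coordCurve hγ.1.1 ?_).differentiableAt
          (by simp))
        rw [hγ.apply_zero]
        exact mem_chart_source E x
      have h1 : HasDerivAt (fun τ : ℝ ↦ t * τ) t 0 := by simpa using (hasDerivAt_id (0:ℝ)).const_mul t
      have h2 : HasDerivAt (coordCurve (E := E) x (fun τ ↦ γ (t * τ))) (t • toCoord x x v) 0 :=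
        hd.scomp 0 h1
      rw [h₁.deriv_coordCurve (mem_chart_source E x), h2.deriv, map_smul]))
  rw [← h1, heq (mem_univ 1)]
  simp only [mul_one]

lemma Exp_zero (hM : IsGeodesicallyComplete E M) (x : M) :
    Exp x (0 : TangentSpace 𝓘(ℝ, E) x) = x := by
  obtain ⟨γ, hγ⟩ := hM x 0
  rw [← zero_smul ℝ (0 : TangentSpace 𝓘(ℝ, E) x), Exp_smul hM hγ, hγ.apply_zero]

/-- Near the origin of `T_x M`, the exponential map read in the chart at `x` is `C²`. -/
lemma exists_coord_Exp (hM : IsGeodesicallyComplete E M) (x : M) :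
    ∃ φ : E → E, ContDiffAt ℝ 2 φ 0 ∧ ∀ᶠ v in 𝓝 (0 : E),
      φ v ∈ (extChartAt 𝓘(ℝ, E) x).target ∧
      Exp x (ofCoord x x v) = (extChartAt 𝓘(ℝ, E) x).symm (φ v) := by
  obtain ⟨φ, hφ, hev⟩ := exists_local_exp (isOpen_extChartAt_target (I := 𝓘(ℝ, E)) x)
    (mem_extChartAt_target x) (fun y hy ↦ christoffelCLM_contDiffAt hy)
  refine ⟨φ, hφ, ?_⟩
  filter_upwards [hev] with v hv
  obtain ⟨c, w, hc0, hw0, hc1, hcw⟩ := hv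
  have h1mem : (1 : ℝ) ∈ Ioo (-2 : ℝ) 2 := by constructor <;> norm_num
  have h0mem : (0 : ℝ) ∈ Ioo (-2 : ℝ) 2 := by constructor <;> norm_num
  refine ⟨by rw [← hc1]; exact (hcw 1 h1mem).1, ?_⟩
  obtain ⟨γ₁, h₁, hγ1⟩ := exists_isGeodesicFrom_one_eq_Exp hM x (ofCoord x x v)
  let γ₂ : ℝ → M := fun t ↦ (extChartAt 𝓘(ℝ, E) x).symm (c t)
  have hcoord : ∀ t ∈ Ioo (-2 : ℝ) 2, coordCurve (E := E) x γ₂ =ᶠ[𝓝 t] c := by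
    intro t ht
    filter_upwards [isOpen_Ioo.mem_nhds ht] with τ hτ
    exact (extChartAt 𝓘(ℝ, E) x).right_inv (hcw τ hτ).1
  have hder : ∀ t ∈ Ioo (-2 : ℝ) 2, deriv (coordCurve (E := E) x γ₂) =ᶠ[𝓝 t] w := by
    intro t ht
    filter_upwards [isOpen_Ioo.mem_nhds ht] with τ hτ
    rw [(hcoord τ hτ).deriv_eq, (hcw τ hτ).2.1.deriv]
  have h₂ : ∀ t ∈ Ioo (-2 : ℝ) 2, IsGeodesicAt (E := E) x γ₂ t := by
    intro t ht
    refine ⟨?_, chart_symm_mem (hcw t ht).1, ?_⟩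
    · exact ContinuousAt.comp (f := c)
        ((chart_symm_contMDiffAt (hcw t ht).1).continuousAt) (hcw t ht).2.1.continuousAt
    · filter_upwards [isOpen_Ioo.mem_nhds ht] with τ hτ
      refine ⟨((hcw τ hτ).2.1.congr_of_eventuallyEq (hcoord τ hτ)).differentiableAt, ?_⟩
      rw [(hcoord τ hτ).self_of_nhds, (hder τ hτ).self_of_nhds]
      exact (hcw τ hτ).2.2.congr_of_eventuallyEq (hder τ hτ)
  have hx2 : γ₂ 0 = x := by
    simp only [γ₂, hc0]
    exact chart_left_inv (mem_chart_source E x)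
  have h10 : IsGeodesicAt (E := E) x γ₁ 0 :=
    h₁.1.isGeodesicAt (by rw [h₁.apply_zero]; exact mem_chart_source E x)
  have heq := h₁.1.eqOn isPreconnected_Ioo (fun t ht ↦ ⟨x, h₂ t ht⟩) h0mem
    (h10.eventuallyEq (h₂ 0 h0mem) (by rw [h₁.apply_zero, hx2]) (by
      rw [h₁.deriv_coordCurve (mem_chart_source E x), toCoord_ofCoord (mem_chart_source E x),
        (hder 0 h0mem).self_of_nhds, hw0]))
  rw [← hγ1, heq h1mem, ← hc1]

end Geodesics

/-! ### The pullback of a function by the exponential map -/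

/-- The second derivative of a function along a curve. -/
lemma hasDerivAt_deriv_comp {F G : Type*} [NormedAddCommGroup F] [NormedSpace ℝ F]
    [NormedAddCommGroup G] [NormedSpace ℝ G] {k : F → G} {c : ℝ → F} {t : ℝ} {a : F}
    (hk : ContDiffAt ℝ 2 k (c t)) (hc : ∀ᶠ τ in 𝓝 t, DifferentiableAt ℝ c τ)
    (ha : HasDerivAt (deriv c) a t) :
    HasDerivAt (deriv (k ∘ c))
      (fderiv ℝ (fderiv ℝ k) (c t) (deriv c t) (deriv c t) + fderiv ℝ k (c t) a) t := by
  have hct := hc.self_of_nhds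
  have h1 : deriv (k ∘ c) =ᶠ[𝓝 t] fun τ ↦ fderiv ℝ k (c τ) (deriv c τ) := by
    filter_upwards [hc, hct.continuousAt.eventually (hk.eventually (by simp))] with τ hτ hkτ
    exact fderiv_comp_deriv τ (hkτ.differentiableAt (by simp)) hτ
  have h2 : HasFDerivAt (fderiv ℝ k) (fderiv ℝ (fderiv ℝ k) (c t)) (c t) :=
    ((hk.fderiv_right (m := 1) (by norm_num)).differentiableAt (by simp)).hasFDerivAt
  have h3 := (h2.comp_hasDerivAt t hct.hasDerivAt).clm_apply ha
  exact h3.congr_of_eventuallyEq h1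

lemma inverse_apply_of_injective {E : Type*} [NormedAddCommGroup E] [NormedSpace ℝ E]
    [FiniteDimensional ℝ E] {b : E →L[ℝ] E →L[ℝ] ℝ} (hb : Function.Injective b) (u : E) :
    b.inverse (b u) = u :=
  hb (apply_inverse_of_injective hb (b u))

section Pullback

variable {E : Type*} [NormedAddCommGroup E] [NormedSpace ℝ E] [FiniteDimensional ℝ E]
  {M : Type*} [TopologicalSpace M] [ChartedSpace E M] [IsManifold 𝓘(ℝ, E) ∞ M]
  [RiemannianBundle (fun x : M ↦ TangentSpace 𝓘(ℝ, E) x)]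

lemma inner_grad {f : M → ℝ} {x : M} (w : TangentSpace 𝓘(ℝ, E) x) :
    inner ℝ (grad f x) w = mvfderiv 𝓘(ℝ, E) f x w :=
  InnerProductSpace.toDual_symm_apply

/-- The coordinates, in the chart at `p₀`, of the gradient of `f`. -/
def gradCoord (f : M → ℝ) (p₀ : M) (y : E) : E :=
  toCoord p₀ ((extChartAt 𝓘(ℝ, E) p₀).symm y) (grad f ((extChartAt 𝓘(ℝ, E) p₀).symm y))

lemma gradCoord_chart (f : M → ℝ) {p₀ p : M} (h : p ∈ (chartAt E p₀).source) :
    gradCoord f p₀ (extChartAt 𝓘(ℝ, E) p₀ p) = toCoord p₀ p (grad f p) := by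
  rw [gradCoord, chart_left_inv h]

lemma metricCLM_gradCoord {f : M → ℝ} (hf : ContMDiff 𝓘(ℝ, E) 𝓘(ℝ, ℝ) 2 f) {p₀ : M} {y : E}
    (hy : y ∈ (extChartAt 𝓘(ℝ, E) p₀).target) :
    metricCLM p₀ y (gradCoord f p₀ y) = fderiv ℝ (f ∘ (extChartAt 𝓘(ℝ, E) p₀).symm) y := by
  obtain ⟨p, hp, rfl⟩ : ∃ p ∈ (chartAt E p₀).source, extChartAt 𝓘(ℝ, E) p₀ p = y :=
    ⟨_, chart_symm_mem hy, (extChartAt 𝓘(ℝ, E) p₀).right_inv hy⟩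
  ext w
  rw [gradCoord_chart f hp, fderiv_comp_chart_symm hp (hf.mdifferentiableAt (by simp)),
    ← inner_grad, metricCLM_chart hp, ofCoord_toCoord hp]

variable [IsContMDiffRiemannianBundle 𝓘(ℝ, E) ∞ E (fun x : M ↦ TangentSpace 𝓘(ℝ, E) x)]

lemma differentiableAt_gradCoord {f : M → ℝ} (hf : ContMDiff 𝓘(ℝ, E) 𝓘(ℝ, ℝ) 2 f) {p₀ : M} {y : E}
    (hy : y ∈ (extChartAt 𝓘(ℝ, E) p₀).target) : DifferentiableAt ℝ (gradCoord f p₀) y := by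
  have h1 : gradCoord f p₀ =ᶠ[𝓝 y] fun z ↦
      (metricCLM p₀ z).inverse (fderiv ℝ (f ∘ (extChartAt 𝓘(ℝ, E) p₀).symm) z) := by
    filter_upwards [(isOpen_extChartAt_target (I := 𝓘(ℝ, E)) p₀).mem_nhds hy] with z hz
    rw [← metricCLM_gradCoord hf hz, inverse_apply_of_injective (metricCLM_injective hz)]
  have h2 : DifferentiableAt ℝ (fun z ↦ (metricCLM p₀ z).inverse) y :=
    (contDiffAt_inverse_of_injective (metricCLM_injective hy)
      (metricCLM_contDiffAt hy)).differentiableAt (by simp)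
  have h3 : DifferentiableAt ℝ (fderiv ℝ (f ∘ (extChartAt 𝓘(ℝ, E) p₀).symm)) y :=
    ((comp_chart_symm_contDiffAt (n := 2) hf hy).fderiv_right
      (m := 1) (by norm_num)).differentiableAt (by simp)
  exact (h2.clm_apply h3).congr_of_eventuallyEq h1

/-- The Riemannian Hessian in coordinates: `Hess f(s, w) = D²f(s, w) - Df(Γ(s, w))`. -/
lemma inner_hess {f : M → ℝ} (hf : ContMDiff 𝓘(ℝ, E) 𝓘(ℝ, ℝ) 2 f) (x : M)
    (s w : TangentSpace 𝓘(ℝ, E) x) :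
    inner ℝ (hess f x s) w =
      fderiv ℝ (fderiv ℝ (f ∘ (extChartAt 𝓘(ℝ, E) x).symm)) (extChartAt 𝓘(ℝ, E) x x)
        (toCoord x x s) (toCoord x x w)
      - fderiv ℝ (f ∘ (extChartAt 𝓘(ℝ, E) x).symm) (extChartAt 𝓘(ℝ, E) x x)
        (christoffelCLM x (extChartAt 𝓘(ℝ, E) x x) (toCoord x x s) (toCoord x x w)) := by
  set y₀ := extChartAt 𝓘(ℝ, E) x x with hy₀
  have hx : x ∈ (chartAt E x).source := mem_chart_source E x
  have hy : y₀ ∈ (extChartAt 𝓘(ℝ, E) x).target := chart_mem hx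
  set F := f ∘ (extChartAt 𝓘(ℝ, E) x).symm with hF
  set s' := toCoord x x s
  set w' := toCoord x x w
  set g₀ := gradCoord f x y₀ with hg₀
  have hY := (differentiableAt_gradCoord hf hy).hasFDerivAt
  have hG := ((metricCLM_contDiffAt hy).differentiableAt (by simp)).hasFDerivAt
  have hFF : HasFDerivAt (fderiv ℝ F) (fderiv ℝ (fderiv ℝ F) y₀) y₀ :=
    (((comp_chart_symm_contDiffAt (n := 2) hf hy).fderiv_right
      (m := 1) (by norm_num)).differentiableAt (by simp)).hasFDerivAt
  have heq : (fun y ↦ metricCLM x y (gradCoord f x y)) =ᶠ[𝓝 y₀] fderiv ℝ F := by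
    filter_upwards [(isOpen_extChartAt_target (I := 𝓘(ℝ, E)) x).mem_nhds hy] with z hz
    exact metricCLM_gradCoord hf hz
  have hder := (hFF.congr_of_eventuallyEq heq).unique (hG.clm_apply hY)
  have hder2 : fderiv ℝ (fderiv ℝ F) y₀ s' w' =
      metricCLM x y₀ (fderiv ℝ (gradCoord f x) y₀ s') w'
        + fderiv ℝ (metricCLM x) y₀ s' g₀ w' := by
    rw [hder]
    simp [hg₀]
  have hhess : hess f x s = ofCoord x x
      (fderiv ℝ (gradCoord f x) y₀ s' + christoffelCLM x y₀ s' g₀) := by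
    rw [hg₀, hy₀, gradCoord_chart f hx, ← christoffel_eq hy]
    rfl
  rw [hhess]
  have h1 : inner ℝ (ofCoord x x (fderiv ℝ (gradCoord f x) y₀ s' + christoffelCLM x y₀ s' g₀)) w
      = metricCLM x y₀ (fderiv ℝ (gradCoord f x) y₀ s' + christoffelCLM x y₀ s' g₀) w' := by
    rw [metricCLM_chart hx, ofCoord_toCoord hx]
  rw [h1, map_add, add_apply, metricCLM_christoffelCLM hy, ← metricCLM_gradCoord hf hy,
    metricCLM_comm x y₀ (gradCoord f x y₀), metricCLM_christoffelCLM hy, ← hg₀, hder2,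
    fderiv_metricCLM_comm hy s' w' g₀, fderiv_metricCLM_comm hy w' s' g₀]
  ring

variable [T2Space M]

lemma contDiffAt_pullback (hM : IsGeodesicallyComplete E M) {f : M → ℝ}
    (hf : ContMDiff 𝓘(ℝ, E) 𝓘(ℝ, ℝ) 2 f) (x : M) :
    ContDiffAt ℝ 2 (fun v : TangentSpace 𝓘(ℝ, E) x ↦ f (Exp x v)) 0 := by
  obtain ⟨φ, hφ, hev⟩ := exists_coord_Exp hM x
  set A : TangentSpace 𝓘(ℝ, E) x →L[ℝ] E := toCoord x x with hA
  have h1 : ContDiffAt ℝ 2 (fun v : E ↦ f (Exp x (ofCoord x x v))) 0 := by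
    refine ContDiffAt.congr_of_eventuallyEq (ContDiffAt.comp 0
      (comp_chart_symm_contDiffAt (n := 2) hf hev.self_of_nhds.1) hφ) ?_
    filter_upwards [hev] with v hv
    rw [Function.comp_apply, Function.comp_apply, ← hv.2]
  rw [← map_zero A] at h1
  have h2 := h1.comp 0 A.contDiff.contDiffAt
  refine h2.congr_of_eventuallyEq (Eventually.of_forall fun v ↦ ?_)
  rw [Function.comp_apply, hA, ofCoord_toCoord (mem_chart_source E x)]

/-- The pullback of `f` along a ray, its first and its second derivative. -/
lemma deriv_pullback (hM : IsGeodesicallyComplete E M) {f : M → ℝ}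
    (hf : ContMDiff 𝓘(ℝ, E) 𝓘(ℝ, ℝ) 2 f) (x : M) (v : TangentSpace 𝓘(ℝ, E) x) :
    fderiv ℝ (fun v : TangentSpace 𝓘(ℝ, E) x ↦ f (Exp x v)) 0 v = inner ℝ (grad f x) v ∧
    fderiv ℝ (fderiv ℝ (fun v : TangentSpace 𝓘(ℝ, E) x ↦ f (Exp x v))) 0 v v
      = inner ℝ (hess f x v) v := by
  set h : TangentSpace 𝓘(ℝ, E) x → ℝ := fun v ↦ f (Exp x v) with hh
  set F := f ∘ (extChartAt 𝓘(ℝ, E) x).symm with hF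
  have hx : x ∈ (chartAt E x).source := mem_chart_source E x
  obtain ⟨γ, hγ⟩ := hM x v
  have hγx : γ 0 ∈ (chartAt E x).source := by rw [hγ.apply_zero]; exact hx
  have hg := hγ.1.isGeodesicAt hγx
  have hc0 : coordCurve (E := E) x γ 0 = extChartAt 𝓘(ℝ, E) x x := by
    rw [coordCurve, hγ.apply_zero]
  have hd0 := hγ.deriv_coordCurve hx
  -- `f` along the geodesic, in the tangent space and in the chart
  have heq : h ∘ (fun t : ℝ ↦ t • v) =ᶠ[𝓝 0] F ∘ coordCurve x γ := by
    filter_upwards [eventually_mem_source hg.1 hγx] with t ht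
    simp only [Function.comp_apply, hh, hF, coordCurve]
    rw [chart_left_inv ht, Exp_smul hM hγ]
  have hlin : ∀ t : ℝ, HasDerivAt (fun t : ℝ ↦ t • v) v t := fun t ↦ by
    simpa using (hasDerivAt_id t).smul_const v
  have hlin' : deriv (fun t : ℝ ↦ t • v) = fun _ ↦ v := funext fun t ↦ (hlin t).deriv
  have hC : ContDiffAt ℝ 2 h ((fun t : ℝ ↦ t • v) 0) := by
    simp only [zero_smul]
    exact contDiffAt_pullback hM hf x
  have hCF : ContDiffAt ℝ 2 F (coordCurve (E := E) x γ 0) := by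
    rw [hc0]
    exact comp_chart_symm_contDiffAt (n := 2) hf (chart_mem hx)
  constructor
  · have h1 := fderiv_comp_deriv (0 : ℝ) (hC.differentiableAt (by simp)) (hlin 0).differentiableAt
    have h2 := fderiv_comp_deriv (0 : ℝ) (hCF.differentiableAt (by simp)) hg.2.2.self_of_nhds.1
    rw [heq.deriv_eq, h2, hc0, hd0, hlin', fderiv_comp_chart_symm hx
      (hf.mdifferentiableAt (by simp)), ofCoord_toCoord hx, ← inner_grad] at h1
    simp only [zero_smul] at h1
    exact h1.symm
  · have h1 := hasDerivAt_deriv_comp hC (Eventually.of_forall fun t ↦ (hlin t).differentiableAt)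
      (a := 0) (by rw [hlin']; exact hasDerivAt_const _ _)
    have h2 := hasDerivAt_deriv_comp hCF (hg.2.2.mono fun _ h ↦ h.1) hg.2.2.self_of_nhds.2
    have h3 := h1.unique (h2.congr_of_eventuallyEq heq.deriv)
    rw [hc0, hd0, hlin', map_neg, ← sub_eq_add_neg, ← inner_hess hf] at h3
    simp only [zero_smul, map_zero, add_zero] at h3
    exact h3

lemma gradient_pullback (hM : IsGeodesicallyComplete E M) {f : M → ℝ}
    (hf : ContMDiff 𝓘(ℝ, E) 𝓘(ℝ, ℝ) 2 f) (x : M) :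
    gradient (fun v : TangentSpace 𝓘(ℝ, E) x ↦ f (Exp x v)) 0 = grad f x := by
  refine ext_inner_right ℝ fun w ↦ ?_
  rw [inner_gradient_left, (deriv_pullback hM hf x w).1]

/-- The Hessian of the pullback at the origin is the Riemannian Hessian: both are symmetric, so
that it suffices to compare the second derivatives along geodesics. -/
lemma hessian_pullback (hM : IsGeodesicallyComplete E M) {f : M → ℝ}
    (hf : ContMDiff 𝓘(ℝ, E) 𝓘(ℝ, ℝ) 2 f) (x : M) (s : TangentSpace 𝓘(ℝ, E) x) :
    fderiv ℝ (gradient (fun v : TangentSpace 𝓘(ℝ, E) x ↦ f (Exp x v))) 0 s = hess f x s := by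
  refine ext_inner_right ℝ fun w ↦ ?_
  have hC := contDiffAt_pullback hM hf x
  rw [inner_fderiv_gradient hC]
  have hsymm := (hC.isSymmSndFDerivAt (by simp)).eq s w
  have hx : x ∈ (chartAt E x).source := mem_chart_source E x
  have hsymm2 := ((comp_chart_symm_contDiffAt (n := 2) hf (chart_mem hx)).isSymmSndFDerivAt
    (by simp)).eq (toCoord x x s) (toCoord x x w)
  have hsymm3 := christoffelCLM_comm (chart_mem hx) (toCoord x x s) (toCoord x x w)
  have h1 := (deriv_pullback hM hf x s).2
  have h2 := (deriv_pullback hM hf x w).2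
  have h3 := (deriv_pullback hM hf x (s + w)).2
  rw [inner_hess hf] at h1 h2 h3 ⊢
  simp only [map_add, add_apply] at h1 h2 h3
  rw [hsymm, hsymm2, hsymm3] at *
  linarith

end Pullback

/-! ### Parallel transport -/

/-- Linear differential equations are solvable on short intervals, whose length depends only on a
bound for the coefficients, from any initial time. -/
lemma exists_hasDerivWithinAt_linear {E : Type*} [NormedAddCommGroup E] [NormedSpace ℝ E]
    [CompleteSpace E] {A : ℝ → E →L[ℝ] E} {a b K : ℝ} (hA : ContinuousOn A (Icc a b))
    (hK : ∀ t ∈ Icc a b, ‖A t‖ ≤ K) (hab : 2 * K * (b - a) ≤ 1) {t₀ : ℝ} (ht₀ : t₀ ∈ Icc a b)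
    (z₀ : E) :
    ∃ z : ℝ → E, z t₀ = z₀ ∧ ∀ t ∈ Icc a b, HasDerivWithinAt z (A t (z t)) (Icc a b) t := by
  have hK0 : 0 ≤ K := (norm_nonneg _).trans (hK t₀ ht₀)
  have hp : IsPicardLindelof (fun t z ↦ A t z) (⟨t₀, ht₀⟩ : Icc a b) z₀ ‖z₀‖₊ 0
      (K.toNNReal * (2 * ‖z₀‖₊)) K.toNNReal := by
    refine ⟨fun t ht ↦ ?_, fun z _ ↦ hA.clm_apply continuousOn_const, fun t ht z hz ↦ ?_, ?_⟩
    · refine ((A t).lipschitz.weaken ?_).lipschitzOnWith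
      rw [← NNReal.coe_le_coe, Real.coe_toNNReal _ hK0]
      exact hK t ht
    · have h1 : ‖z‖ ≤ 2 * ‖z₀‖ := by
        have := norm_le_of_mem_closedBall hz
        simp only [coe_nnnorm] at this
        linarith
      simpa [Real.coe_toNNReal _ hK0] using (A t).le_of_opNorm_le_of_le (hK t ht) h1
    · have h1 : max (b - t₀) (t₀ - a) ≤ b - a := max_le (by linarith [ht₀.1]) (by linarith [ht₀.2])
      simp only [NNReal.coe_mul, Real.coe_toNNReal _ hK0, NNReal.coe_ofNat, coe_nnnorm,
        NNReal.coe_zero, sub_zero]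
      calc K * (2 * ‖z₀‖) * max (b - t₀) (t₀ - a) ≤ K * (2 * ‖z₀‖) * (b - a) := by gcongr
        _ = (2 * K * (b - a)) * ‖z₀‖ := by ring
        _ ≤ 1 * ‖z₀‖ := by gcongr
        _ = ‖z₀‖ := one_mul _
  obtain ⟨z, hz0, hz⟩ := hp.exists_eq_forall_mem_Icc_hasDerivWithinAt (x := z₀)
    (Metric.mem_closedBall_self (by simp))
  exact ⟨z, hz0, hz⟩

section ParallelTransport

variable {E : Type*} [NormedAddCommGroup E] [NormedSpace ℝ E] [FiniteDimensional ℝ E]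
  {M : Type*} [TopologicalSpace M] [ChartedSpace E M] [IsManifold 𝓘(ℝ, E) ∞ M]
  [RiemannianBundle (fun x : M ↦ TangentSpace 𝓘(ℝ, E) x)]
  [IsContMDiffRiemannianBundle 𝓘(ℝ, E) ∞ E (fun x : M ↦ TangentSpace 𝓘(ℝ, E) x)]

/-- The behaviour of the Christoffel symbols under a change of charts.  Both sides are symmetric
bilinear forms, and they agree on the diagonal because geodesics satisfy the geodesic equation in
both charts. -/
lemma christoffelCLM_chart_change (hM : IsGeodesicallyComplete E M) {p₀ q z : M}
    (hp : z ∈ (chartAt E p₀).source) (hq : z ∈ (chartAt E q).source) (u v : E) :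
    christoffelCLM p₀ (extChartAt 𝓘(ℝ, E) p₀ z) (toCoord p₀ z (ofCoord q z u))
        (toCoord p₀ z (ofCoord q z v))
      = toCoord p₀ z (ofCoord q z (christoffelCLM q (extChartAt 𝓘(ℝ, E) q z) u v))
        - fderiv ℝ (fderiv ℝ (extChartAt 𝓘(ℝ, E) p₀ ∘ (extChartAt 𝓘(ℝ, E) q).symm))
          (extChartAt 𝓘(ℝ, E) q z) u v := by
  set k := extChartAt 𝓘(ℝ, E) p₀ ∘ (extChartAt 𝓘(ℝ, E) q).symm with hk
  have hkC : ContDiffAt ℝ 2 k (extChartAt 𝓘(ℝ, E) q z) :=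
    contDiffAt_infty.1 (chart_change_contDiffAt hp hq) 2
  have diag : ∀ v : E, christoffelCLM p₀ (extChartAt 𝓘(ℝ, E) p₀ z) (toCoord p₀ z (ofCoord q z v))
        (toCoord p₀ z (ofCoord q z v))
      = toCoord p₀ z (ofCoord q z (christoffelCLM q (extChartAt 𝓘(ℝ, E) q z) v v))
        - fderiv ℝ (fderiv ℝ k) (extChartAt 𝓘(ℝ, E) q z) v v := by
    intro v
    obtain ⟨γ, hγ⟩ := hM z (ofCoord q z v)
    have hγp : γ 0 ∈ (chartAt E p₀).source := by rwa [hγ.apply_zero]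
    have hγq : γ 0 ∈ (chartAt E q).source := by rwa [hγ.apply_zero]
    have hgp := hγ.1.isGeodesicAt hγp
    have hgq := hγ.1.isGeodesicAt hγq
    have hcp : coordCurve (E := E) p₀ γ 0 = extChartAt 𝓘(ℝ, E) p₀ z := by
      rw [coordCurve, hγ.apply_zero]
    have hcq : coordCurve (E := E) q γ 0 = extChartAt 𝓘(ℝ, E) q z := by
      rw [coordCurve, hγ.apply_zero]
    have h1 := hasDerivAt_deriv_comp (k := k) (by rwa [hcq]) (hgq.2.2.mono fun _ h ↦ h.1)
      hgq.2.2.self_of_nhds.2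
    have h2 := h1.congr_of_eventuallyEq
      (coordCurve_eventuallyEq_comp (E := E) (p₀ := p₀) hgp.1 hγq).deriv
    have h3 := hgp.2.2.self_of_nhds.2.unique h2
    rw [hcp, hcq, hγ.deriv_coordCurve hp, hγ.deriv_coordCurve hq, toCoord_ofCoord hq, map_neg,
      fderiv_chart_change hp hq] at h3
    rw [neg_eq_iff_eq_neg.1 h3]
    abel
  have hs1 := christoffelCLM_comm (chart_mem hp) (toCoord p₀ z (ofCoord q z u))
    (toCoord p₀ z (ofCoord q z v))
  have hs2 := christoffelCLM_comm (chart_mem hq) u v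
  have hs3 := (hkC.isSymmSndFDerivAt (by simp)).eq u v
  have h1 := diag u
  have h2 := diag v
  have h3 := diag (u + v)
  simp only [map_add, add_apply] at h3
  rw [h1, h2, ← hs1, ← hs2, ← hs3] at h3
  have h4 : (2 : ℝ) • christoffelCLM p₀ (extChartAt 𝓘(ℝ, E) p₀ z) (toCoord p₀ z (ofCoord q z u))
        (toCoord p₀ z (ofCoord q z v))
      = (2 : ℝ) • (toCoord p₀ z (ofCoord q z (christoffelCLM q (extChartAt 𝓘(ℝ, E) q z) u v))
        - fderiv ℝ (fderiv ℝ k) (extChartAt 𝓘(ℝ, E) q z) u v) := by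
    rw [two_smul, two_smul, ← sub_eq_zero]
    rw [← sub_eq_zero] at h3
    rw [← h3]
    abel
  exact smul_right_injective E (two_ne_zero (α := ℝ)) h4

lemma IsParallelOn.mono {γ : ℝ → M} {Z : ∀ t, TangentSpace 𝓘(ℝ, E) (γ t)} {J J' : Set ℝ}
    (h : IsParallelOn γ Z J) (hJ : J' ⊆ J) : IsParallelOn γ Z J' :=
  fun p₀ t ht hs ↦ (h p₀ t (hJ ht) hs).mono hJ

/-- Concatenation of parallel fields. -/
lemma IsParallelOn.exists_union {γ : ℝ → M} {Z₁ Z₂ : ∀ t, TangentSpace 𝓘(ℝ, E) (γ t)} {a b c : ℝ}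
    (hab : a ≤ b) (hbc : b ≤ c)
    (h₁ : IsParallelOn γ Z₁ (Icc a b)) (h₂ : IsParallelOn γ Z₂ (Icc b c)) (hb : Z₁ b = Z₂ b) :
    ∃ Z : ∀ t, TangentSpace 𝓘(ℝ, E) (γ t), IsParallelOn γ Z (Icc a c) ∧ Z c = Z₂ c := by
  let Z : ∀ t, TangentSpace 𝓘(ℝ, E) (γ t) := fun t ↦ if t ≤ b then Z₁ t else Z₂ t
  have e₁ : ∀ t ∈ Icc a b, Z t = Z₁ t := fun t ht ↦ if_pos ht.2
  have e₂ : ∀ t ∈ Icc b c, Z t = Z₂ t := by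
    intro t ht
    by_cases h : t ≤ b
    · obtain rfl : t = b := le_antisymm h ht.1
      rw [← hb]
      exact if_pos h
    · exact if_neg h
  have k₁ : IsParallelOn γ Z (Icc a b) := by
    intro p₀ t ht hs
    have := h₁ p₀ t ht hs
    rw [← e₁ t ht] at this
    exact this.congr (fun τ hτ ↦ by rw [e₁ τ hτ]) (by rw [e₁ t ht])
  have k₂ : IsParallelOn γ Z (Icc b c) := by
    intro p₀ t ht hs
    have := h₂ p₀ t ht hs
    rw [← e₂ t ht] at this
    exact this.congr (fun τ hτ ↦ by rw [e₂ τ hτ]) (by rw [e₂ t ht])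
  refine ⟨Z, ?_, e₂ c ⟨hbc, le_rfl⟩⟩
  intro p₀ t ht hs
  rcases lt_trichotomy t b with h | rfl | h
  · refine (k₁ p₀ t ⟨ht.1, h.le⟩ hs).mono_of_mem_nhdsWithin ?_
    filter_upwards [self_mem_nhdsWithin, mem_nhdsWithin_of_mem_nhds (Iio_mem_nhds h)] with τ h1 h2
    exact ⟨h1.1, le_of_lt h2⟩
  · have := (k₁ p₀ t ⟨hab, le_rfl⟩ hs).union (k₂ p₀ t ⟨le_rfl, hbc⟩ hs)
    rwa [Icc_union_Icc_eq_Icc hab hbc] at this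
  · refine (k₂ p₀ t ⟨h.le, ht.2⟩ hs).mono_of_mem_nhdsWithin ?_
    filter_upwards [self_mem_nhdsWithin, mem_nhdsWithin_of_mem_nhds (Ioi_mem_nhds h)] with τ h1 h2
    exact ⟨le_of_lt h2, h1.2⟩

/-- Parallel fields exist on a neighbourhood of any given time, with prescribed value at any time
in that neighbourhood. -/
lemma exists_isParallelOn_nhds (hM : IsGeodesicallyComplete E M) {γ : ℝ → M}
    (hγ : ContMDiff 𝓘(ℝ, ℝ) 𝓘(ℝ, E) ∞ γ) (t₀ : ℝ) :
    ∃ δ > 0, ∀ b ∈ Icc (t₀ - δ) (t₀ + δ), ∀ v : TangentSpace 𝓘(ℝ, E) (γ b),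
      ∃ Z : ∀ t, TangentSpace 𝓘(ℝ, E) (γ t),
        IsParallelOn γ Z (Icc (t₀ - δ) (t₀ + δ)) ∧ Z b = v := by
  set q := γ t₀ with hq
  set c := coordCurve (E := E) q γ with hc
  let A : ℝ → E →L[ℝ] E := fun τ ↦ -christoffelCLM q (c τ) (deriv c τ)
  have hAc : ∀ τ, γ τ ∈ (chartAt E q).source → ContinuousAt A τ := by
    intro τ hτ
    have h1 : ContDiffAt ℝ ∞ c τ := contDiffAt_coordCurve hγ hτ
    have h2 : ContinuousAt (deriv c) τ := by
      have h3 : ContinuousAt (fderiv ℝ c) τ := (h1.fderiv_right (m := 0) (by simp)).continuousAt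
      exact h3.clm_apply continuousAt_const
    have h4 : ContinuousAt (fun τ ↦ christoffelCLM q (c τ)) τ :=
      ContinuousAt.comp (f := c) (christoffelCLM_contDiffAt (chart_mem hτ)).continuousAt
        h1.continuousAt
    exact (h4.clm_apply h2).neg
  set K := ‖A t₀‖ + 1 with hK
  have hK0 : 0 < K := by positivity
  have hev : ∀ᶠ τ in 𝓝 t₀, γ τ ∈ (chartAt E q).source ∧ ‖A τ‖ ≤ K := by
    refine (eventually_mem_source hγ.continuous.continuousAt (mem_chart_source E q)).and ?_
    refine ((hAc t₀ (mem_chart_source E q)).norm.eventually_lt_const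
      (lt_add_one ‖A t₀‖)).mono fun _ h ↦ le_of_lt h
  obtain ⟨r, hr, hball⟩ := Metric.eventually_nhds_iff.1 hev
  set δ := min (r / 2) (1 / (4 * K)) with hδ
  have hδ0 : 0 < δ := by positivity
  have hδr : δ < r := (min_le_left _ _).trans_lt (by linarith)
  have hδK : 2 * K * ((t₀ + δ) - (t₀ - δ)) ≤ 1 := by
    have : δ ≤ 1 / (4 * K) := min_le_right _ _
    rw [le_div_iff₀ (by positivity)] at this
    linarith
  have hJ : ∀ τ ∈ Icc (t₀ - δ) (t₀ + δ), γ τ ∈ (chartAt E q).source ∧ ‖A τ‖ ≤ K := by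
    intro τ hτ
    apply hball
    rw [Real.dist_eq, abs_lt]
    constructor <;> linarith [hτ.1, hτ.2]
  refine ⟨δ, hδ0, fun b hb v ↦ ?_⟩
  obtain ⟨z, hzb, hz⟩ := exists_hasDerivWithinAt_linear
    (fun τ hτ ↦ (hAc τ (hJ τ hτ).1).continuousWithinAt) (fun τ hτ ↦ (hJ τ hτ).2) hδK hb
    (toCoord q (γ b) v)
  refine ⟨fun τ ↦ ofCoord q (γ τ) (z τ), ?_, ?_⟩
  swap
  · change ofCoord q (γ b) (z b) = v
    rw [hzb, ofCoord_toCoord (hJ b hb).1]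
  intro p₀ t ht hs
  have htq := (hJ t ht).1
  set k := extChartAt 𝓘(ℝ, E) p₀ ∘ (extChartAt 𝓘(ℝ, E) q).symm with hk
  have hkC : ContDiffAt ℝ ∞ k (c t) := chart_change_contDiffAt hs htq
  have hcd : HasDerivAt c (deriv c t) t :=
    ((contDiffAt_coordCurve hγ htq).differentiableAt (by simp)).hasDerivAt
  have heq : (fun τ ↦ toCoord p₀ (γ τ) (ofCoord q (γ τ) (z τ))) =ᶠ[𝓝 t]
      fun τ ↦ fderiv ℝ k (c τ) (z τ) := by
    filter_upwards [eventually_mem_source hγ.continuous.continuousAt hs,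
      eventually_mem_source hγ.continuous.continuousAt htq] with τ h1 h2
    exact (fderiv_chart_change h1 h2 _).symm
  have hD : HasFDerivAt (fderiv ℝ k) (fderiv ℝ (fderiv ℝ k) (c t)) (c t) :=
    (((contDiffAt_infty.1 hkC 2).fderiv_right (m := 1) (by norm_num)).differentiableAt (by simp)).hasFDerivAt
  have hder := ((hD.comp_hasDerivAt t hcd).hasDerivWithinAt (s := Icc (t₀ - δ) (t₀ + δ))).clm_apply
    (hz t ht)
  refine (hder.congr_of_eventuallyEq (heq.filter_mono nhdsWithin_le_nhds)
    heq.self_of_nhds).congr_deriv ?_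
  have hvel : deriv (fun τ ↦ extChartAt 𝓘(ℝ, E) p₀ (γ τ)) t
      = toCoord p₀ (γ t) (ofCoord q (γ t) (deriv c t)) := by
    have h1 := (coordCurve_eventuallyEq_comp (E := E) (p₀ := p₀)
      hγ.continuous.continuousAt htq).deriv_eq
    change deriv (coordCurve (E := E) p₀ γ) t = _
    rw [h1, fderiv_comp_deriv t (hkC.differentiableAt (by simp)) hcd.differentiableAt]
    exact fderiv_chart_change hs htq _
  rw [hvel, christoffel_eq (chart_mem hs), christoffelCLM_chart_change hM hs htq,
    ← fderiv_chart_change hs htq (christoffelCLM _ _ _ _)]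
  simp only [A, Function.comp_apply, neg_apply, map_neg]
  rw [neg_sub, sub_eq_add_neg]
  rfl

/-- Parallel transport from time `1` back to time `0` exists. -/
lemma exists_isParallelOn (hM : IsGeodesicallyComplete E M) {γ : ℝ → M}
    (hγ : ContMDiff 𝓘(ℝ, ℝ) 𝓘(ℝ, E) ∞ γ) (w : TangentSpace 𝓘(ℝ, E) (γ 1)) :
    ∃ Z : ∀ t, TangentSpace 𝓘(ℝ, E) (γ t), IsParallelOn γ Z (Icc 0 1) ∧ Z 1 = w := by
  let S : Set ℝ := {a | a ∈ Icc (0 : ℝ) 1 ∧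
    ∃ Z : ∀ t, TangentSpace 𝓘(ℝ, E) (γ t), IsParallelOn γ Z (Icc a 1) ∧ Z 1 = w}
  have h1S : (1 : ℝ) ∈ S := by
    obtain ⟨δ, hδ, h⟩ := exists_isParallelOn_nhds hM hγ 1
    obtain ⟨Z, hZ, hZ1⟩ := h 1 ⟨by linarith, by linarith⟩ w
    exact ⟨⟨zero_le_one, le_rfl⟩, Z, hZ.mono (Icc_subset_Icc (by linarith) (by linarith)), hZ1⟩
  have hbdd : BddBelow S := ⟨0, fun a ha ↦ ha.1.1⟩
  set m := sInf S with hm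
  obtain ⟨δ, hδ, h⟩ := exists_isParallelOn_nhds hM hγ m
  obtain ⟨a, haS, ham⟩ := exists_lt_of_csInf_lt ⟨1, h1S⟩ (show sInf S < m + δ by linarith)
  have hma : m ≤ a := csInf_le hbdd haS
  obtain ⟨haI, Z, hZ, hZ1⟩ := haS
  obtain ⟨Z', hZ', hZa⟩ := h a ⟨by linarith, ham.le⟩ (Z a)
  set a' := max 0 (m - δ) with ha'
  have ha'a : a' ≤ a := max_le haI.1 (by linarith)
  obtain ⟨Y, hY, hY1⟩ := IsParallelOn.exists_union ha'a haI.2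
    (hZ'.mono (Icc_subset_Icc (le_max_right _ _) ham.le)) hZ hZa
  have ha'S : a' ∈ S := ⟨⟨le_max_left _ _, ha'a.trans haI.2⟩, Y, hY, hY1.trans hZ1⟩
  have hma' : m ≤ a' := csInf_le hbdd ha'S
  have ha'0 : a' = 0 := by
    rcases max_choice 0 (m - δ) with h0 | h0
    · exact h0
    · rw [ha', h0] at hma'
      linarith
  rw [ha'0] at ha'S
  exact ha'S.2

/-- Parallel transport is isometric: the Riemannian connection is compatible with the metric. -/
lemma IsParallelOn.norm_eq {γ : ℝ → M} (hγ : ContMDiff 𝓘(ℝ, ℝ) 𝓘(ℝ, E) ∞ γ)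
    {Z : ∀ t, TangentSpace 𝓘(ℝ, E) (γ t)} (hZ : IsParallelOn γ Z (Icc 0 1)) :
    ‖Z 1‖ = ‖Z 0‖ := by
  have hder : ∀ t ∈ Icc (0 : ℝ) 1, HasDerivWithinAt (fun τ ↦ ‖Z τ‖ ^ 2) 0 (Icc 0 1) t := by
    intro t ht
    set q := γ t with hq
    have hs : γ t ∈ (chartAt E q).source := mem_chart_source E _
    set c := coordCurve (E := E) q γ with hc
    have hy : c t ∈ (extChartAt 𝓘(ℝ, E) q).target := chart_mem hs
    have hcd : HasDerivAt c (deriv c t) t :=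
      ((contDiffAt_coordCurve hγ hs).differentiableAt (by simp)).hasDerivAt
    have hz := hZ q t ht hs
    rw [christoffel_eq (chart_mem hs)] at hz
    have hG := ((metricCLM_contDiffAt hy).differentiableAt (by simp)).hasFDerivAt
    have h1 := (((hG.comp_hasDerivAt t hcd).hasDerivWithinAt (s := Icc 0 1)).clm_apply hz).clm_apply
      hz
    have heq : (fun τ ↦ ‖Z τ‖ ^ 2) =ᶠ[𝓝 t] fun τ ↦
        metricCLM q (c τ) (toCoord q (γ τ) (Z τ)) (toCoord q (γ τ) (Z τ)) := by
      filter_upwards [eventually_mem_source hγ.continuous.continuousAt hs] with τ hτ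
      rw [← real_inner_self_eq_norm_sq]
      exact (metricCLM_toCoord hτ _ _).symm
    refine (h1.congr_of_eventuallyEq (heq.filter_mono nhdsWithin_le_nhds)
      heq.self_of_nhds).congr_deriv ?_
    change (fderiv ℝ (metricCLM q) (c t) (deriv c t) (toCoord q (γ t) (Z t))
      + metricCLM q (c t) (-christoffelCLM q (c t) (deriv c t) (toCoord q (γ t) (Z t))))
        (toCoord q (γ t) (Z t))
      + metricCLM q (c t) (toCoord q (γ t) (Z t))
        (-christoffelCLM q (c t) (deriv c t) (toCoord q (γ t) (Z t))) = 0
    rw [metricCLM_comm q (c t) (toCoord q (γ t) (Z t)), add_apply, map_neg, neg_apply,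
      metricCLM_christoffelCLM hy, fderiv_metricCLM_comm hy (toCoord q (γ t) (Z t)) (deriv c t)]
    ring
  have hconst := constant_of_has_deriv_right_zero
    (fun t ht ↦ (hder t ht).continuousWithinAt)
    (fun t ht ↦ (hder t (Ico_subset_Icc_self ht)).mono_of_mem_nhdsWithin
      (by
        filter_upwards [self_mem_nhdsWithin, mem_nhdsWithin_of_mem_nhds (Iio_mem_nhds ht.2)]
          with τ h1 h2
        exact ⟨ht.1.trans h1, le_of_lt h2⟩)) 1 ⟨zero_le_one, le_rfl⟩
  exact (sq_eq_sq₀ (norm_nonneg _) (norm_nonneg _)).1 hconst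

variable [T2Space M]

lemma norm_transportInv (hM : IsGeodesicallyComplete E M) (x : M) (s : TangentSpace 𝓘(ℝ, E) x)
    (w : TangentSpace 𝓘(ℝ, E) (Exp x s)) : ‖transportInv x s w‖ = ‖w‖ := by
  obtain ⟨γ, hγ⟩ := hM x s
  have hfun : (fun t : ℝ ↦ Exp x (t • s)) = γ := funext fun t ↦ Exp_smul hM hγ t
  have hγ1 : γ 1 = Exp x s := by rw [← Exp_smul hM hγ, one_smul]
  obtain ⟨w', hw'⟩ : ∃ w', (⟨γ 1, w'⟩ : TangentBundle 𝓘(ℝ, E) M) = ⟨Exp x s, w⟩ := by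
    rw [hγ1]
    exact ⟨w, rfl⟩
  obtain ⟨Z, hZ, hZ1⟩ := exists_isParallelOn hM hγ.1.1 w'
  obtain ⟨u, hu⟩ : ∃ u, (⟨γ 0, Z 0⟩ : TangentBundle 𝓘(ℝ, E) M) = ⟨x, u⟩ := by
    generalize Z 0 = z
    revert z
    rw [hγ.apply_zero]
    exact fun z ↦ ⟨z, rfl⟩
  have hex : ∃ u : TangentSpace 𝓘(ℝ, E) x,
      IsParallelTransport (fun t : ℝ ↦ Exp x (t • s)) ⟨x, u⟩ ⟨Exp x s, w⟩ := by
    rw [hfun]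
    exact ⟨u, Z, hZ, hu, by rw [hZ1, hw']⟩
  have hspec : IsParallelTransport (fun t : ℝ ↦ Exp x (t • s)) ⟨x, transportInv x s w⟩
      ⟨Exp x s, w⟩ := Classical.epsilon_spec hex
  rw [hfun] at hspec
  obtain ⟨Y, hY, hY0, hY1⟩ := hspec
  have h0 : ‖Y 0‖ = ‖transportInv x s w‖ :=
    congrArg (fun p : TangentBundle 𝓘(ℝ, E) M ↦ ‖p.2‖) hY0
  have h1 : ‖Y 1‖ = ‖w‖ := congrArg (fun p : TangentBundle 𝓘(ℝ, E) M ↦ ‖p.2‖) hY1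
  rw [← h0, ← h1, hY.norm_eq hγ.1.1]

end ParallelTransport

/-! ### Counting iterations -/

section Counting

/-- A base `C < 0` gives `C ^ (3 / 2) = 0` in Mathlib, since `cos (3 π / 2) = 0`. -/
lemma rpow_three_halves_nonneg (C : ℝ) : 0 ≤ C ^ (3 / 2 : ℝ) := by
  rcases le_or_gt 0 C with h | h
  · positivity
  · rw [Real.rpow_def_of_neg h, show (3 / 2 : ℝ) * Real.pi = Real.pi / 2 + Real.pi by ring,
      Real.cos_add_pi, Real.cos_pi_div_two, neg_zero, mul_zero]

lemma rpow_three_halves_le_pow {a C n : ℝ} (hC : 0 < C) (ha : 0 ≤ a) (hn : 0 ≤ n)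
    (h : a ≤ C * n ^ 2) : a ^ (3 / 2 : ℝ) / C ^ (3 / 2 : ℝ) ≤ n ^ 3 := by
  rw [← Real.div_rpow ha hC.le]
  have h1 : a / C ≤ n ^ 2 := by rwa [div_le_iff₀' hC]
  calc (a / C) ^ (3 / 2 : ℝ) ≤ (n ^ 2) ^ (3 / 2 : ℝ) := by gcongr
    _ = n ^ 3 := by
      rw [← Real.rpow_natCast, ← Real.rpow_mul hn, ← Real.rpow_natCast]
      norm_num

/-- What the convergence analysis uses of a run: `F k` and `g k` are the cost and the gradient norm
at the `k`-th iterate, `n k` is the length of the step, `ς k` the regularization parameter, and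
`succ k` says that iteration `k` is successful. -/
structure RunEstimates (N : ℕ∞) (succ : ℕ → Prop) (F g n ς : ℕ → ℝ)
    (Flow c C γ₁ γ₂ ςm : ℝ) : Prop where
  low : ∀ k, Flow ≤ F k
  step_nonneg : ∀ k, 0 ≤ n k
  g_nonneg : ∀ k, 0 ≤ g k
  decrease : ∀ k : ℕ, (k : ℕ∞) < N → succ k → F (k + 1) ≤ F k - c * n k ^ 3
  stay : ∀ k : ℕ, (k : ℕ∞) < N → ¬ succ k → F (k + 1) = F k ∧ g (k + 1) = g k
  gradient_le : ∀ k : ℕ, (k : ℕ∞) < N → succ k → g (k + 1) ≤ C * n k ^ 2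
  reg_succ : ∀ k : ℕ, (k : ℕ∞) < N → succ k → γ₁ * ς k ≤ ς (k + 1)
  reg_unsucc : ∀ k : ℕ, (k : ℕ∞) < N → ¬ succ k → γ₂ * ς k ≤ ς (k + 1)
  reg_pos : ∀ k : ℕ, (k : ℕ∞) ≤ N → 0 < ς k
  reg_le : ∀ k : ℕ, (k : ℕ∞) ≤ N → ς k ≤ ςm
  terminal : ∀ k : ℕ, N = k → g k = 0

variable {N : ℕ∞} {succ : ℕ → Prop} {F g n ς : ℕ → ℝ} {Flow c C γ₁ γ₂ ςm : ℝ}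

lemma lt_of_succ_le {N : ℕ∞} {k : ℕ} (h : ((k + 1 : ℕ) : ℕ∞) ≤ N) : (k : ℕ∞) < N :=
  lt_of_lt_of_le (by exact_mod_cast Nat.lt_succ_self k) h

namespace RunEstimates

lemma succ_le (h : RunEstimates N succ F g n ς Flow c C γ₁ γ₂ ςm) (hc : 0 < c) {k : ℕ}
    (hk : (k : ℕ∞) < N) : F (k + 1) ≤ F k := by
  by_cases hs : succ k
  · have := h.decrease k hk hs
    have : 0 ≤ c * n k ^ 3 := mul_nonneg hc.le (pow_nonneg (h.step_nonneg k) 3)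
    linarith
  · exact (h.stay k hk hs).1.le

lemma le_initial (h : RunEstimates N succ F g n ς Flow c C γ₁ γ₂ ςm) (hc : 0 < c) {k : ℕ}
    (hk : (k : ℕ∞) ≤ N) : F k ≤ F 0 := by
  induction k with
  | zero => exact le_rfl
  | succ k ih => exact (h.succ_le hc (lt_of_succ_le hk)).trans (ih (lt_of_succ_le hk).le)

/-- Every successful iteration which leads to a gradient larger than `ε` decreases the cost by at
least `c (ε / C) ^ (3 / 2)`; the total decrease is at most `F 0 - Flow`. -/
lemma card_le (h : RunEstimates N succ F g n ς Flow c C γ₁ γ₂ ςm) (hc : 0 < c) {ε : ℝ}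
    (hε : 0 < ε) {T : Finset ℕ} (hT : ∀ k ∈ T, (k : ℕ∞) < N ∧ succ k ∧ ε < g (k + 1)) :
    (T.card : ℝ) ≤ (F 0 - Flow) / c * C ^ (3 / 2 : ℝ) * (1 / ε ^ (3 / 2 : ℝ)) := by
  have hΔ : 0 ≤ F 0 - Flow := sub_nonneg.2 (h.low 0)
  rcases T.eq_empty_or_nonempty with rfl | hne
  · simp only [Finset.card_empty, Nat.cast_zero]
    have := rpow_three_halves_nonneg C
    positivity
  obtain ⟨k₀, hk₀⟩ := hne
  have hC : 0 < C := by
    obtain ⟨h1, h2, h3⟩ := hT k₀ hk₀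
    have h4 := h.gradient_le k₀ h1 h2
    by_contra hC
    have : C * n k₀ ^ 2 ≤ 0 := mul_nonpos_of_nonpos_of_nonneg (not_lt.1 hC) (sq_nonneg _)
    linarith
  set d := c * (ε ^ (3 / 2 : ℝ) / C ^ (3 / 2 : ℝ)) with hd
  have hd0 : 0 < d := by positivity
  have hterm : ∀ k ∈ T, d ≤ F k - F (k + 1) := by
    intro k hk
    obtain ⟨h1, h2, h3⟩ := hT k hk
    have h4 := rpow_three_halves_le_pow hC hε.le (h.step_nonneg k)
      (h3.le.trans (h.gradient_le k h1 h2))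
    have h5 := h.decrease k h1 h2
    have h6 : d ≤ c * n k ^ 3 := mul_le_mul_of_nonneg_left h4 hc.le
    linarith
  set m := T.sup id + 1 with hm
  have hTm : T ⊆ Finset.range m := fun k hk ↦
    Finset.mem_range.2 (Nat.lt_succ_of_le (Finset.le_sup (f := id) hk))
  have hmax : ∀ k ∈ Finset.range m, (k : ℕ∞) < N := by
    intro k hk
    obtain ⟨j, hj, hjm⟩ := Finset.exists_mem_eq_sup T ⟨k₀, hk₀⟩ id
    have : k ≤ j := by
      have := Finset.mem_range.1 hk
      rw [hm, hjm] at this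
      exact Nat.lt_succ_iff.1 this
    exact lt_of_le_of_lt (by exact_mod_cast this) (hT j hj).1
  have hsum : T.card * d ≤ F 0 - Flow := by
    calc (T.card : ℝ) * d = ∑ _k ∈ T, d := by rw [Finset.sum_const, nsmul_eq_mul]
      _ ≤ ∑ k ∈ T, (F k - F (k + 1)) := Finset.sum_le_sum hterm
      _ ≤ ∑ k ∈ Finset.range m, (F k - F (k + 1)) :=
        Finset.sum_le_sum_of_subset_of_nonneg hTm fun k hk _ ↦
          sub_nonneg.2 (h.succ_le hc (hmax k hk))
      _ = F 0 - F m := Finset.sum_range_sub' F m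
      _ ≤ F 0 - Flow := by linarith [h.low m]
  rw [← le_div_iff₀ hd0] at hsum
  refine hsum.trans (le_of_eq ?_)
  rw [hd]
  field_simp

lemma finite_ncard_le (h : RunEstimates N succ F g n ς Flow c C γ₁ γ₂ ςm) (hc : 0 < c) {ε : ℝ}
    (hε : 0 < ε) :
    {k : ℕ | (k : ℕ∞) < N ∧ succ k ∧ ε < g (k + 1)}.Finite ∧
    ({k : ℕ | (k : ℕ∞) < N ∧ succ k ∧ ε < g (k + 1)}.ncard : ℝ)
      ≤ (F 0 - Flow) / c * C ^ (3 / 2 : ℝ) * (1 / ε ^ (3 / 2 : ℝ)) := by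
  have hfin : {k : ℕ | (k : ℕ∞) < N ∧ succ k ∧ ε < g (k + 1)}.Finite := by
    by_contra hinf
    obtain ⟨K, hK⟩ := exists_nat_gt ((F 0 - Flow) / c * C ^ (3 / 2 : ℝ) * (1 / ε ^ (3 / 2 : ℝ)))
    obtain ⟨T, hT, hcard⟩ := Set.Infinite.exists_subset_card_eq hinf K
    have := h.card_le hc hε (T := T) fun k hk ↦ hT hk
    rw [hcard] at this
    linarith
  refine ⟨hfin, ?_⟩
  rw [Set.ncard_eq_toFinset_card _ hfin]
  exact h.card_le hc hε fun k hk ↦ hfin.mem_toFinset.1 hk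

/-- Infinitely many iterations of an infinite run are successful, since the regularization
parameter grows geometrically along unsuccessful ones. -/
lemma exists_succ_ge (h : RunEstimates ⊤ succ F g n ς Flow c C γ₁ γ₂ ςm) (hγ₂ : 1 < γ₂) (k₀ : ℕ) :
    ∃ k ≥ k₀, succ k := by
  by_contra! hcon
  have hpow : ∀ j : ℕ, γ₂ ^ j * ς k₀ ≤ ς (k₀ + j) := by
    intro j
    induction j with
    | zero => simp
    | succ j ih =>
      have := h.reg_unsucc (k₀ + j) (ENat.natCast_lt_top _) (hcon _ (Nat.le_add_right _ _))
      calc γ₂ ^ (j + 1) * ς k₀ = γ₂ * (γ₂ ^ j * ς k₀) := by ring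
        _ ≤ γ₂ * ς (k₀ + j) := by gcongr
        _ ≤ ς (k₀ + (j + 1)) := this
  have hpos := h.reg_pos k₀ le_top
  obtain ⟨j, hj⟩ := pow_unbounded_of_one_lt (ςm / ς k₀) hγ₂
  rw [div_lt_iff₀ hpos] at hj
  linarith [hpow j, h.reg_le (k₀ + j) le_top]

lemma tendsto_zero (h : RunEstimates ⊤ succ F g n ς Flow c C γ₁ γ₂ ςm) (hc : 0 < c)
    (hγ₂ : 1 < γ₂) : Tendsto g atTop (𝓝 0) := by
  rw [Metric.tendsto_atTop]
  intro ε hε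
  obtain ⟨b, hb⟩ := (h.finite_ncard_le hc (half_pos hε)).1.bddAbove
  obtain ⟨k₁, hk₁, hs₁⟩ := h.exists_succ_ge hγ₂ (b + 1)
  have hgood : ∀ k ≥ k₁, succ k → g (k + 1) ≤ ε / 2 := by
    intro k hk hs
    by_contra hlt
    have : k ≤ b := hb ⟨ENat.natCast_lt_top k, hs, not_le.1 hlt⟩
    omega
  have hall : ∀ k ≥ k₁ + 1, g k ≤ ε / 2 := by
    intro k hk
    induction k, hk using Nat.le_induction with
    | base => exact hgood k₁ le_rfl hs₁
    | succ k hk ih =>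
      by_cases hs : succ k
      · exact hgood k (by omega) hs
      · rw [(h.stay k (ENat.natCast_lt_top k) hs).2]
        exact ih
  refine ⟨k₁ + 1, fun k hk ↦ ?_⟩
  rw [Real.dist_eq, sub_zero, abs_of_nonneg (h.g_nonneg k)]
  linarith [hall k hk]

/-- The number of unsuccessful iterations is controlled by that of successful ones, because the
regularization parameter stays bounded. -/
lemma log_reg_ge [DecidablePred succ] (h : RunEstimates N succ F g n ς Flow c C γ₁ γ₂ ςm)
    (hγ₁ : 0 < γ₁) (hγ₂ : 1 < γ₂) {m : ℕ} (hm : (m : ℕ∞) ≤ N) :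
    Real.log (ς 0) + ((Finset.range m).filter succ).card * Real.log γ₁
      + (m - ((Finset.range m).filter succ).card) * Real.log γ₂ ≤ Real.log (ς m) := by
  induction m with
  | zero => simp
  | succ m ih =>
    have hmN := lt_of_succ_le hm
    have ih := ih hmN.le
    have hpos := h.reg_pos m hmN.le
    rw [Finset.range_add_one, Finset.filter_insert]
    by_cases hs : succ m
    · have h1 := Real.log_le_log (by positivity) (h.reg_succ m hmN hs)
      rw [Real.log_mul hγ₁.ne' hpos.ne'] at h1
      rw [if_pos hs, Finset.card_insert_of_notMem (by simp)]
      push_cast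
      linarith
    · have h1 := Real.log_le_log (by positivity) (h.reg_unsucc m hmN hs)
      rw [Real.log_mul (by positivity) hpos.ne'] at h1
      rw [if_neg hs]
      push_cast
      linarith

lemma exists_small (h : RunEstimates N succ F g n ς Flow c C γ₁ γ₂ ςm) (hc : 0 < c)
    (hγ₁ : 0 < γ₁) (hγ₁' : γ₁ < 1) (hγ₂ : 1 < γ₂) {ε : ℝ} (hε : 0 < ε) :
    ∃ k : ℕ, (k : ℕ∞) ≤ N ∧
      (k : ℝ) ≤ (1 + |Real.log γ₁| / Real.log γ₂)
            * ((F 0 - Flow) / c * C ^ (3 / 2 : ℝ) * (1 / ε ^ (3 / 2 : ℝ)))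
          + 1 / Real.log γ₂ * Real.log (ςm / ς 0) + 1 ∧
      F k ≤ F 0 ∧ g k ≤ ε := by
  classical
  have hex : ∃ k : ℕ, (k : ℕ∞) ≤ N ∧ g k ≤ ε := by
    induction N using ENat.recTopCoe with
    | top =>
      obtain ⟨k, hk⟩ := ((h.tendsto_zero hc hγ₂).eventually_lt_const hε).exists
      exact ⟨k, le_top, hk.le⟩
    | coe N => exact ⟨N, le_rfl, by rw [h.terminal N rfl]; exact hε.le⟩
  set K := (F 0 - Flow) / c * C ^ (3 / 2 : ℝ) * (1 / ε ^ (3 / 2 : ℝ)) with hK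
  have hK0 : 0 ≤ K := by
    have := rpow_three_halves_nonneg C
    have := sub_nonneg.2 (h.low 0)
    positivity
  have hlog₂ : 0 < Real.log γ₂ := Real.log_pos hγ₂
  have hς0 : 0 < ς 0 := h.reg_pos 0 (by simp)
  have hςm : 0 < ςm := hς0.trans_le (h.reg_le 0 (by simp))
  obtain ⟨hkN, hkε⟩ := Nat.find_spec hex
  refine ⟨Nat.find hex, hkN, ?_, h.le_initial hc hkN, hkε⟩
  rcases hfind : Nat.find hex with _ | m
  · have h1 : 0 ≤ Real.log (ςm / ς 0) :=
      Real.log_nonneg ((one_le_div hς0).2 (h.reg_le 0 (by simp)))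
    rw [Nat.cast_zero]
    positivity
  · rw [hfind] at hkN
    have hmN := lt_of_succ_le hkN
    set S := (Finset.range m).filter succ with hS
    -- a successful iteration before the last one leads to a gradient larger than `ε`
    have hcard : (S.card : ℝ) ≤ K := by
      refine h.card_le hc hε fun k hk ↦ ?_
      obtain ⟨hkm, hks⟩ := Finset.mem_filter.1 hk
      have hkm := Finset.mem_range.1 hkm
      have hkN : ((k + 1 : ℕ) : ℕ∞) ≤ N :=
        le_trans (by exact_mod_cast hkm) hmN.le
      refine ⟨lt_of_succ_le hkN, hks, ?_⟩
      have := Nat.find_min hex (m := k + 1) (by omega)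
      exact not_le.1 fun hle ↦ this ⟨hkN, hle⟩
    have h1 := h.log_reg_ge hγ₁ hγ₂ hmN.le
    have h2 := Real.log_le_log (h.reg_pos m hmN.le) (h.reg_le m hmN.le)
    rw [← hS] at h1
    rw [Real.log_div hςm.ne' hς0.ne', abs_of_neg (Real.log_neg hγ₁ hγ₁')]
    have h3 : (m : ℝ) ≤ (1 + -Real.log γ₁ / Real.log γ₂) * S.card
        + 1 / Real.log γ₂ * (Real.log ςm - Real.log (ς 0)) := by
      have h4 : (m : ℝ) * Real.log γ₂ ≤ ((1 + -Real.log γ₁ / Real.log γ₂) * S.card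
          + 1 / Real.log γ₂ * (Real.log ςm - Real.log (ς 0))) * Real.log γ₂ := by
        have h5 : ((1 + -Real.log γ₁ / Real.log γ₂) * S.card
          + 1 / Real.log γ₂ * (Real.log ςm - Real.log (ς 0))) * Real.log γ₂ =
          (Real.log γ₂ - Real.log γ₁) * S.card + (Real.log ςm - Real.log (ς 0)) := by
          field_simp
          ring
        rw [h5]
        linarith
      exact le_of_mul_le_mul_right h4 hlog₂
    have h6 : (1 + -Real.log γ₁ / Real.log γ₂) * S.card
        ≤ (1 + -Real.log γ₁ / Real.log γ₂) * K := by
      have : 0 ≤ -Real.log γ₁ := neg_nonneg.2 (Real.log_neg hγ₁ hγ₁').le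
      gcongr
    push_cast
    linarith

end RunEstimates

end Counting

/-! ### Runs of the algorithm -/

section Run

variable {E : Type*} [NormedAddCommGroup E] [NormedSpace ℝ E] [FiniteDimensional ℝ E]
  {M : Type*} [TopologicalSpace M] [T2Space M] [ChartedSpace E M] [IsManifold 𝓘(ℝ, E) ∞ M]
  [RiemannianBundle (fun x : M ↦ TangentSpace 𝓘(ℝ, E) x)]
  [IsContMDiffRiemannianBundle 𝓘(ℝ, E) ∞ E (fun x : M ↦ TangentSpace 𝓘(ℝ, E) x)]

lemma model_zero (hM : IsGeodesicallyComplete E M) (f : M → ℝ) (x : M) (ς : ℝ) :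
    model f Exp x ς (0 : TangentSpace 𝓘(ℝ, E) x) = f x := by
  simp [model, cubicModel, taylor2, Exp_zero hM]

lemma gradient_model (hM : IsGeodesicallyComplete E M) {f : M → ℝ}
    (hf : ContMDiff 𝓘(ℝ, E) 𝓘(ℝ, ℝ) 2 f) (x : M) (ς : ℝ) (s : TangentSpace 𝓘(ℝ, E) x) :
    gradient (model f Exp x ς) s = grad f x + hess f x s + (ς * ‖s‖) • s := by
  have h := gradient_cubicModel (contDiffAt_pullback hM hf x) ς s
  rw [gradient_pullback hM hf, hessian_pullback hM hf] at h
  exact h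

/-- The step estimate: the gradient after a step at which the model is almost critical. -/
lemma norm_grad_Exp_le (hM : IsGeodesicallyComplete E M) {f : M → ℝ}
    (hf : ContMDiff 𝓘(ℝ, E) 𝓘(ℝ, ℝ) 2 f) {x : M} {ς θ L' : ℝ} {s : TangentSpace 𝓘(ℝ, E) x}
    (hς : 0 ≤ ς) (hprog : ‖gradient (model f Exp x ς) s‖ ≤ θ * ‖s‖ ^ 2)
    (hL' : ‖transportInv x s (grad f (Exp x s)) - grad f x - hess f x s‖ ≤ L' / 2 * ‖s‖ ^ 2) :
    ‖grad (E := E) f (Exp x s)‖ ≤ (L' / 2 + θ + ς) * ‖s‖ ^ 2 := by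
  rw [← norm_transportInv hM]
  rw [gradient_model hM hf] at hprog
  have h1 : transportInv x s (grad f (Exp x s)) =
      (transportInv x s (grad f (Exp x s)) - grad f x - hess f x s)
        + (grad f x + hess f x s + (ς * ‖s‖) • s) - (ς * ‖s‖) • s := by abel
  have h2 : ‖(ς * ‖s‖) • s‖ = ς * ‖s‖ ^ 2 := by
    rw [norm_smul, Real.norm_of_nonneg (by positivity)]
    ring
  rw [h1]
  refine (norm_sub_le _ _).trans ?_
  have h3 := norm_add_le (transportInv x s (grad f (Exp x s)) - grad f x - hess f x s)
    (grad f x + hess f x s + (ς * ‖s‖) • s)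
  rw [h2]
  linarith

variable {P : Params} {f : M → ℝ} {N : ℕ∞} {x : ℕ → M} {s : ∀ k, TangentSpace 𝓘(ℝ, E) (x k)}
  {ς : ℕ → ℝ}

lemma IsRun.ςmin_le (hrun : IsRun P f Exp N x s ς) {k : ℕ} (hk : (k : ℕ∞) ≤ N) :
    P.ςmin ≤ ς k := by
  induction k with
  | zero => exact hrun.init
  | succ k ih =>
    have hkN := lt_of_succ_le hk
    have ih := ih hkN.le
    have hpos : 0 < ς k := P.ςmin_pos.trans_le ih
    by_cases h1 : P.η₂ ≤ ratio f Exp (x k) (ς k) (s k)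
    · exact (le_max_left _ _).trans (hrun.very_successful k hkN h1).1
    by_cases h2 : P.η₁ ≤ ratio f Exp (x k) (ς k) (s k)
    · exact ih.trans (hrun.successful k hkN h2 (not_le.1 h1)).1
    · have h3 := (hrun.unsuccessful k hkN (not_le.1 h2)).1
      have h4 : 1 * ς k ≤ P.γ₂ * ς k := mul_le_mul_of_nonneg_right P.γ₂_gt.le hpos.le
      linarith

lemma IsRun.denominator_ge (hrun : IsRun P f Exp N x s ς) {k : ℕ}
    (hk : (k : ℕ∞) ≤ N) :
    ς k / 3 * ‖s k‖ ^ 3 ≤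
      model (E := E) f Exp (x k) (ς k) 0 - model f Exp (x k) (ς k) (s k)
        + ς k / 3 * ‖s k‖ ^ 3 := by
  linarith [hrun.decrease k hk]

lemma IsRun.norm_step_pos (hrun : IsRun P f Exp N x s ς) {k : ℕ} (hk : (k : ℕ∞) < N) :
    0 < ‖s k‖ :=
  norm_pos_iff.2 fun h ↦ hk.ne ((hrun.terminate_iff k hk.le).1 h)

/-- The iteration is very successful as soon as the regularization parameter is large. -/
lemma IsRun.very_successful_of_le (hM : IsGeodesicallyComplete E M)
    (hrun : IsRun P f Exp N x s ς) {L : ℝ} {k : ℕ} (hk : (k : ℕ∞) < N)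
    (hA2 : f (Exp (x k) (s k)) - taylor2 (fun v ↦ f (Exp (x k) v)) (s k) ≤ L / 6 * ‖s k‖ ^ 3)
    (hL : L ≤ 2 * (1 - P.η₂) * ς k) : P.η₂ ≤ ratio f Exp (x k) (ς k) (s k) := by
  have hς : 0 < ς k := P.ςmin_pos.trans_le (hrun.ςmin_le hk.le)
  have hn := hrun.norm_step_pos hk
  have hden := hrun.denominator_ge hk.le
  have hpos : 0 < ς k / 3 * ‖s k‖ ^ 3 := by positivity
  rw [ratio, le_div_iff₀ (hpos.trans_le hden)]
  have h1 : (1 - P.η₂) * (ς k / 3 * ‖s k‖ ^ 3) ≤ (1 - P.η₂) *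
      (model (E := E) f Exp (x k) (ς k) 0 - model f Exp (x k) (ς k) (s k) + ς k / 3 * ‖s k‖ ^ 3) :=
    mul_le_mul_of_nonneg_left hden (by linarith [P.η₂_lt])
  have h2 : L / 6 * ‖s k‖ ^ 3 ≤ 2 * (1 - P.η₂) * ς k / 6 * ‖s k‖ ^ 3 := by gcongr
  have h3 : model f Exp (x k) (ς k) (s k)
      = taylor2 (fun v ↦ f (Exp (x k) v)) (s k) + ς k / 3 * ‖s k‖ ^ 3 := rfl
  have h4 := model_zero hM f (x k) (ς k)
  linarith

lemma IsRun.le_ςmax (hM : IsGeodesicallyComplete E M) (hrun : IsRun P f Exp N x s ς) {L : ℝ}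
    (hA2 : ∀ k : ℕ, (k : ℕ∞) < N →
      f (Exp (x k) (s k)) - taylor2 (fun v ↦ f (Exp (x k) v)) (s k) ≤ L / 6 * ‖s k‖ ^ 3)
    {k : ℕ} (hk : (k : ℕ∞) ≤ N) : ς k ≤ ςmax P L (ς 0) := by
  induction k with
  | zero => exact le_max_left _ _
  | succ k ih =>
    have hkN := lt_of_succ_le hk
    have ih := ih hkN.le
    have hpos : 0 < ς k := P.ςmin_pos.trans_le (hrun.ςmin_le hkN.le)
    have hγ₃ : 0 < P.γ₃ := by linarith [P.γ₂_gt, P.γ₃_gt]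
    by_cases h1 : P.η₂ ≤ ratio f Exp (x k) (ς k) (s k)
    · exact (hrun.very_successful k hkN h1).2.trans ih
    have hη : 0 < 2 * (1 - P.η₂) := by linarith [P.η₂_lt]
    have h2 : 2 * (1 - P.η₂) * ς k < L := by
      by_contra hL
      exact h1 (hrun.very_successful_of_le hM hkN (hA2 k hkN) (not_lt.1 hL))
    have h3 : P.γ₃ * ς k ≤ ςmax P L (ς 0) := by
      refine le_trans ?_ (le_max_right _ _)
      rw [le_div_iff₀ hη]
      calc P.γ₃ * ς k * (2 * (1 - P.η₂)) = P.γ₃ * (2 * (1 - P.η₂) * ς k) := by ring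
        _ ≤ P.γ₃ * L := by gcongr
        _ = L * P.γ₃ := mul_comm _ _
    refine le_trans ?_ h3
    by_cases h4 : P.η₁ ≤ ratio f Exp (x k) (ς k) (s k)
    · refine (hrun.successful k hkN h4 (not_le.1 h1)).2.trans ?_
      exact mul_le_mul_of_nonneg_right P.γ₃_gt.le hpos.le
    · exact (hrun.unsuccessful k hkN (not_le.1 h4)).2

lemma IsRun.runEstimates (hM : IsGeodesicallyComplete E M) (hrun : IsRun P f Exp N x s ς)
    {f_low L L' : ℝ} (hA1 : ∀ p, f_low ≤ f p) (hf : ContMDiff 𝓘(ℝ, E) 𝓘(ℝ, ℝ) 2 f)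
    (hA2 : ∀ k : ℕ, (k : ℕ∞) < N →
      f (Exp (x k) (s k)) - taylor2 (fun v ↦ f (Exp (x k) v)) (s k) ≤ L / 6 * ‖s k‖ ^ 3)
    (hA3 : ∀ k : ℕ, (k : ℕ∞) < N → P.η₁ ≤ ratio f Exp (x k) (ς k) (s k) →
      ‖transportInv (x k) (s k) (grad f (Exp (x k) (s k))) - grad f (x k) - hess f (x k) (s k)‖
        ≤ L' / 2 * ‖s k‖ ^ 2) :
    RunEstimates N (fun k ↦ P.η₁ ≤ ratio f Exp (x k) (ς k) (s k)) (fun k ↦ f (x k))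
      (fun k ↦ ‖grad (E := E) f (x k)‖) (fun k ↦ ‖s k‖) ς f_low (P.η₁ * P.ςmin / 3)
      (L' / 2 + P.θ + ςmax P L (ς 0)) P.γ₁ P.γ₂ (ςmax P L (ς 0)) where
  low k := hA1 _
  step_nonneg k := norm_nonneg _
  g_nonneg k := norm_nonneg _
  decrease k hk hs := by
    have hς := hrun.ςmin_le hk.le
    have hς0 : 0 < ς k := P.ςmin_pos.trans_le hς
    have hn := hrun.norm_step_pos hk
    have hden := hrun.denominator_ge hk.le
    have hpos : 0 < ς k / 3 * ‖s k‖ ^ 3 := by positivity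
    have h1 := hs
    rw [ratio, le_div_iff₀ (hpos.trans_le hden)] at h1
    have h2 : P.ςmin / 3 * ‖s k‖ ^ 3 ≤ ς k / 3 * ‖s k‖ ^ 3 := by gcongr
    have h3 := mul_le_mul_of_nonneg_left (h2.trans hden) P.η₁_pos.le
    rw [hrun.step k hk, if_pos hs]
    linarith
  stay k hk hs := by
    rw [hrun.step k hk, if_neg hs]
    exact ⟨rfl, rfl⟩
  gradient_le k hk hs := by
    have hς0 : 0 < ς k := P.ςmin_pos.trans_le (hrun.ςmin_le hk.le)
    have h1 := norm_grad_Exp_le hM hf hς0.le (hrun.progress k hk.le) (hA3 k hk hs)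
    rw [hrun.step k hk, if_pos hs]
    refine h1.trans ?_
    have := hrun.le_ςmax hM hA2 hk.le
    gcongr
  reg_succ k hk hs := by
    by_cases h1 : P.η₂ ≤ ratio f Exp (x k) (ς k) (s k)
    · exact (le_max_right _ _).trans (hrun.very_successful k hk h1).1
    · refine le_trans ?_ (hrun.successful k hk hs (not_le.1 h1)).1
      have hς0 : 0 < ς k := P.ςmin_pos.trans_le (hrun.ςmin_le hk.le)
      exact mul_le_of_le_one_left hς0.le P.γ₁_lt.le
  reg_unsucc k hk hs := (hrun.unsuccessful k hk (not_le.1 hs)).1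
  reg_pos k hk := P.ςmin_pos.trans_le (hrun.ςmin_le hk)
  reg_le k hk := hrun.le_ςmax hM hA2 hk
  terminal k hk := by
    have hs : s k = 0 := (hrun.terminate_iff k hk.ge).2 hk.symm
    have h2 := hrun.progress k hk.ge
    rw [gradient_model hM hf, ← hessian_pullback hM hf, hs] at h2
    simpa using h2

end Run

lemma K₁_eq (P : Params) (L L' ς₀ Δ ε : ℝ) :
    K₁ P L L' ς₀ Δ ε = Δ / (P.η₁ * P.ςmin / 3) * (L' / 2 + P.θ + ςmax P L ς₀) ^ (3 / 2 : ℝ)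
      * (1 / ε ^ (3 / 2 : ℝ)) := by
  rw [K₁, div_div_eq_mul_div, mul_comm Δ 3]

end RiemannianARC

end

theorem mainTheorem1
    {E : Type*} [NormedAddCommGroup E] [NormedSpace ℝ E] [FiniteDimensional ℝ E]
    {M : Type*} [TopologicalSpace M] [T2Space M] [ChartedSpace E M] [IsManifold 𝓘(ℝ, E) ∞ M]
    [RiemannianBundle (fun x : M ↦ TangentSpace 𝓘(ℝ, E) x)]
    [IsContMDiffRiemannianBundle 𝓘(ℝ, E) ∞ E (fun x : M ↦ TangentSpace 𝓘(ℝ, E) x)]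
    (hM : RiemannianARC.IsGeodesicallyComplete E M)
    (P : RiemannianARC.Params) (f : M → ℝ) (N : ℕ∞) (x : ℕ → M)
    (s : ∀ k, TangentSpace 𝓘(ℝ, E) (x k)) (ς : ℕ → ℝ)
    (hrun : RiemannianARC.IsRun P f RiemannianARC.Exp N x s ς)
    (f_low L L' : ℝ)
    -- `f` is lower bounded
    (hA1 : ∀ p, f_low ≤ f p)
    -- `f` is `C²`, and its pullbacks are bounded cubically at the trial steps
    (hf : ContMDiff 𝓘(ℝ, E) 𝓘(ℝ, ℝ) 2 f)
    (hA2 : ∀ k : ℕ, (k : ℕ∞) < N →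
      f (RiemannianARC.Exp (x k) (s k))
        - RiemannianARC.taylor2 (fun v ↦ f (RiemannianARC.Exp (x k) v)) (s k)
        ≤ L / 6 * ‖s k‖ ^ 3)
    -- Lipschitz-type bound on the gradient at the successful iterations
    (hA3 : ∀ k : ℕ, (k : ℕ∞) < N →
      P.η₁ ≤ RiemannianARC.ratio f RiemannianARC.Exp (x k) (ς k) (s k) →
      ‖RiemannianARC.transportInv (x k) (s k)
            (RiemannianARC.grad f (RiemannianARC.Exp (x k) (s k)))
          - RiemannianARC.grad f (x k) - RiemannianARC.hess f (x k) (s k)‖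
        ≤ L' / 2 * ‖s k‖ ^ 2) :
    -- the total number of successful iterations `k` with `‖grad f(x_{k+1})‖ > ε`
    (∀ ε : ℝ, 0 < ε →
      {k : ℕ | (k : ℕ∞) < N ∧
        P.η₁ ≤ RiemannianARC.ratio f RiemannianARC.Exp (x k) (ς k) (s k) ∧
        ε < ‖RiemannianARC.grad (E := E) f (x (k + 1))‖}.Finite ∧
      ({k : ℕ | (k : ℕ∞) < N ∧
        P.η₁ ≤ RiemannianARC.ratio f RiemannianARC.Exp (x k) (ς k) (s k) ∧
        ε < ‖RiemannianARC.grad (E := E) f (x (k + 1))‖}.ncard : ℝ)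
        ≤ RiemannianARC.K₁ P L L' (ς 0) (f (x 0) - f_low) ε) ∧
    -- the gradients tend to zero (and vanish at the last iterate if the run terminates)
    (N = ⊤ → Tendsto (fun k ↦ ‖RiemannianARC.grad (E := E) f (x k)‖) atTop (𝓝 0)) ∧
    (∀ n : ℕ, N = n → RiemannianARC.grad (E := E) f (x n) = 0) ∧
    -- the total number of iterations needed to reach an `ε`-critical point
    (∀ ε : ℝ, 0 < ε → ∃ k : ℕ, (k : ℕ∞) ≤ N ∧
      (k : ℝ) ≤ (1 + |Real.log P.γ₁| / Real.log P.γ₂)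
            * RiemannianARC.K₁ P L L' (ς 0) (f (x 0) - f_low) ε
          + 1 / Real.log P.γ₂ * Real.log (RiemannianARC.ςmax P L (ς 0) / ς 0) + 1 ∧
      f (x k) ≤ f (x 0) ∧ ‖RiemannianARC.grad (E := E) f (x k)‖ ≤ ε) := by
  have h := hrun.runEstimates hM hA1 hf hA2 hA3
  have hc : 0 < P.η₁ * P.ςmin / 3 := by
    have := P.η₁_pos
    have := P.ςmin_pos
    positivity
  simp only [RiemannianARC.K₁_eq]
  refine ⟨fun ε hε ↦ h.finite_ncard_le hc hε, ?_, fun n hn ↦ norm_eq_zero.1 (h.terminal n hn),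
    fun ε hε ↦ h.exists_small hc P.γ₁_pos P.γ₁_lt P.γ₂_gt hε⟩
  rintro rfl
  exact h.tendsto_zero hc P.γ₂_gt
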